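/- **Setting.** Let $E=\bigoplus_{i\in\mathbb Z}E_i$ be a graded real vector space. A symmetric vector valued $k$-form is a graded symmetric $k$-linear map $E\times\dots\times E\to E$ (exchanging neighbouring homogeneous arguments $X,Y$ multiplies the value by $(-1)^{|X||Y|}$); formal sums of such forms with varying $k$ are allowed. For vector valued forms $K$ (with $k$ arguments) and $L$ (with $l\ge 1$ arguments), the insertion $\iota_KL$ has $k+l-1$ arguments and is $$\iota_KL(X_1,\dots,X_{k+l-1})=\sum_{\sigma\in Sh(k,l-1)}\epsilon(\sigma)\,L\big(K(X_{\sigma(1)},\dots,X_{\sigma(k)}),X_{\sigma(k+1)},\dots,X_{\sigma(k+l-1)}\big),$$ with $\epsilon(\sigma)$ the Koszul sign, and $\iota_KL=0$ for $l=0$; it is extended biadditively to formal sums. The Richardson–Nijenhuis bracket of $K$ of degree $\bar K$ and $L$ of degree $\bar L$ is $[K,L]=\iota_KL-(-1)^{\bar K\bar L}\iota_LK$. The Euler map $S$ is the vector valued $1$-form $S(X)=-|X|X$ for homogeneous $X$. Given a symmetric vector valued form $\mu$ of degree $1$, a symmetric vector valued form $N$ of degree $0$ is *Nijenhuis with respect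 to $\mu$ with square $K$*, where $K$ is a symmetric vector valued form of degree $0$, if $[N,[N,\mu]]=[K,\mu]$ and $[N,K]=0$. Let $(M,\omega)$ be an $n$-plectic manifold: $\omega$ is a closed $(n+1)$-form on the smooth manifold $M$ such that $\iota_v\omega=0$ implies $v=0$ for every tangent vector $v$. An $(n-1)$-form $\alpha$ is Hamiltonian if there is a vector field $\chi_\alpha$ (necessarily unique) with $d\alpha=-\iota_{\chi_\alpha}\omega$. Here $(\iota_X\alpha)(v_1,v_2,\dots)=\alpha(X,v_1,v_2,\dots)$. Let $E_{-1}=\Omega^{n-1}_{Ham}(M)$ be the space of Hamiltonian forms, $E_i=\Omega^{n+i}(M)$ for $-n\le i\le -2$, and $E_i=0$ otherwise. Fix a sign $s\in\{1,-1\}$. Let $l_1(\alpha)=s(-1)^{|\alpha|}d\alpha$ for homogeneous $\alpha\notin E_{-1}$ and $l_1=0$ on $E_{-1}$. For $2\le k\le n+1$ let $l_k$ be the symmetric vector valued $k$-form which vanishes if one of its arguments is homogeneous of degree different from $-1$, and which for $\beta_1,\dots,\beta_k\in E_{-1}$ is $$l_k(\beta_1,\dots,\beta_k)=\begin{cases}(-1)^{\frac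 k2+1}\,\iota_{\chi_{\beta_1}}\cdots\iota_{\chi_{\beta_k}}\omega & k\text{ even},\\(-1)^{\frac{k-1}2}\,\iota_{\chi_{\beta_1}}\cdots\iota_{\chi_{\beta_k}}\omega & k\text{ odd.}\end{cases}$$ Put $\mu=l_1+\dots+l_{n+1}$. **Theorem.** Let $\eta\in\Omega^n(M)$ be any $n$-form. For $2\le i\le n$ let $\tilde\eta_i$ be the vector valued $i$-form with $$\tilde\eta_i(\beta_1,\dots,\beta_i)=\iota_{\chi_{\beta_1}}\cdots\iota_{\chi_{\beta_i}}\eta\in E_{-i}\qquad(\beta_1,\dots,\beta_i\in E_{-1}),$$ vanishing if one of the arguments is homogeneous of degree different from $-1$, and put $\tilde\eta_1=0$, $\tilde\eta_{n+1}=0$. Then $\mu$ is symmetric of degree $1$, and $$N=S+\sum_{i=2}^n\tilde\eta_i$$ is a Nijenhuis vector valued form with respect to $\mu$, with square $S+2\sum_{i=2}^n\tilde\eta_i$. The deformed structure is $[N,\mu]=\sum_{i=1}^{n+1}l_i^N$, where $$l_1^N=l_1,\qquad l_i^N=l_i+s(-1)^i\,d\circ\tilde\eta_i-\iota_{l_2}\tilde\eta_{i-1}\quad(2\le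 i\le n+1),$$ and $d\circ\tilde\eta_i$ is the exterior derivative of the value of $\tilde\eta_i$ (so that $s(-1)^i\,d\circ\tilde\eta_i=l_1\circ\tilde\eta_i$). -/

import Mathlib

open scoped Manifold ContDiff Topology DirectSum
open Set Filter

noncomputable section
namespace NPlectic

/-! ### Graded vector spaces and vector valued forms -/

section Graded

open DirectSum

variable (E : ℤ → Type*) [∀ i, AddCommGroup (E i)] [∀ i, Module ℝ (E i)]

/-- Multilinear maps `E × ⋯ × E → E` in `k` arguments, where `E = ⨁ i, E i` is a graded vector
space. The symmetric vector valued `k`-forms are those satisfying `IsGradedSymmetric`. -/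
abbrev KForm (k : ℕ) : Type _ := MultilinearMap ℝ (fun _ : Fin k => ⨁ i, E i) (⨁ i, E i)

/-- Formal sums `K_0 + K_1 + K_2 + ⋯` with `K_k` a `k`-linear map. -/
abbrev VForm : Type _ := ∀ k : ℕ, KForm E k

variable {E}

/-- Graded symmetry: exchanging two neighbouring homogeneous arguments `X`, `Y` multiplies the
value by `(-1)^{|X||Y|}`. -/
def IsGradedSymmetric (K : VForm E) : Prop :=
  ∀ (k : ℕ) (a : Fin k → ℤ) (x : ∀ j, E (a j)) (p q : Fin k), (q : ℕ) = p + 1 →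
    K k (fun j => of E (a (Equiv.swap p q j)) (x (Equiv.swap p q j))) =
      (a p * a q).negOnePow • K k (fun j => of E (a j) (x j))

/-- `K` has degree `d`: it maps homogeneous elements of degrees `a_1, …, a_k` to homogeneous
elements of degree `a_1 + ⋯ + a_k + d`. -/
def HasDegree (K : VForm E) (d : ℤ) : Prop :=
  ∀ (k : ℕ) (a : Fin k → ℤ) (x : ∀ j, E (a j)),
    K k (fun j => of E (a j) (x j)) ∈ LinearMap.range (lof ℝ ℤ E (∑ j, a j + d))

/-- The Koszul sign of the shuffle which moves the arguments with index in `s` in front of the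
others, for homogeneous arguments of degrees `a`. -/
def koszulSign {m : ℕ} (s : Finset (Fin m)) (a : Fin m → ℤ) : ℤˣ :=
  ∏ i ∈ s, ∏ j ∈ sᶜ with j < i, (a i * a j).negOnePow

/-- The multilinear map `X ↦ L (K (X_s), X_{sᶜ})`, where `X_s` and `X_{sᶜ}` are the arguments with
index in `s`, resp. not in `s`, in increasing order. -/
def insertPlain {m : ℕ} (s : Finset (Fin m)) (K : KForm E s.card) (L : KForm E (sᶜ.card + 1)) :
    KForm E m :=
  (MultilinearMap.uncurrySum (N := fun _ : Fin s.card ⊕ Fin sᶜ.card => ⨁ i, E i)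
    (L.curryLeft.compMultilinearMap K)).domDomCongr (finSumEquivOfFinset rfl rfl)

/-- The insertion operator `ι_K L`. On homogeneous arguments, its component with `m` arguments is
the sum of `ε(σ) L_l (K_k (X_{σ(1)}, …, X_{σ(k)}), X_{σ(k+1)}, …, X_{σ(m)})` over all `k + l = m + 1`,
`l ≥ 1`, and all `(k, l - 1)`-shuffles `σ`; such a shuffle is given by the subset
`s = {σ(1), …, σ(k)}` of the set of arguments, and `ε(σ)` is its Koszul sign. -/
def insertion (K L : VForm E) : VForm E := fun m =>
  ∑ s : Finset (Fin m), MultilinearMap.fromDirectSumEquiv (κ := fun _ => ℤ) (M := fun _ => E)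
    (fun a => koszulSign s a •
      (insertPlain s (K s.card) (L (sᶜ.card + 1))).compLinearMap fun j => lof ℝ ℤ E (a j))

/-- The Richardson-Nijenhuis bracket `[K, L] = ι_K L - (-1)^{p q} ι_L K` of a form `K` of degree `p`
and a form `L` of degree `q`. -/
def rnBracket (p q : ℤ) (K L : VForm E) : VForm E :=
  insertion K L - (p * q).negOnePow • insertion L K

variable (E) in
/-- The Euler map `S`, with `S X = -|X| X` for homogeneous `X`, as a vector valued `1`-form. -/
def euler : VForm E :=
  Pi.single 1 (MultilinearMap.ofSubsingleton ℝ (⨁ i, E i) (⨁ i, E i) (0 : Fin 1)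
    (toModule ℝ ℤ (⨁ i, E i) fun i => (-(i : ℝ)) • lof ℝ ℤ E i))

/-- `N` is a Nijenhuis vector valued form with respect to the vector valued form `μ` of degree `1`,
with square `K`. All of them are graded symmetric. -/
structure IsNijenhuisWithSquare (μ N K : VForm E) : Prop where
  symm_structure : IsGradedSymmetric μ
  degree_structure : HasDegree μ 1
  symm_form : IsGradedSymmetric N
  degree_form : HasDegree N 0
  symm_square : IsGradedSymmetric K
  degree_square : HasDegree K 0
  deform_deform : rnBracket 0 1 N (rnBracket 0 1 N μ) = rnBracket 0 1 K μ
  commute : rnBracket 0 0 N K = 0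

end Graded

/-! ### Differential forms, vector fields -/


variable {F : Type*} [NormedAddCommGroup F] [NormedSpace ℝ F]
  {M : Type*} [TopologicalSpace M] [ChartedSpace F M]

/-- The expression of a `k`-form in the chart at `x₀`: its pullback under the inverse of the chart. -/
def coordRep {k : ℕ} (α : ∀ x : M, TangentSpace 𝓘(ℝ, F) x [⋀^Fin k]→L[ℝ] ℝ) (x₀ : M) (y : F) :
    F [⋀^Fin k]→L[ℝ] ℝ :=
  (α ((extChartAt 𝓘(ℝ, F) x₀).symm y)).compContinuousLinearMap
    (mfderiv 𝓘(ℝ, F) 𝓘(ℝ, F) (extChartAt 𝓘(ℝ, F) x₀).symm y)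

variable (F M) in
/-- The smooth differential `k`-forms on `M`: families of alternating forms on the tangent spaces
whose expressions in all charts are smooth. -/
def smoothForms (k : ℕ) : Submodule ℝ (∀ x : M, TangentSpace 𝓘(ℝ, F) x [⋀^Fin k]→L[ℝ] ℝ) where
  carrier := {α | ∀ x₀ : M, ContDiffOn ℝ ∞ (coordRep α x₀) (extChartAt 𝓘(ℝ, F) x₀).target}
  zero_mem' := fun _ => contDiffOn_const (c := 0)
  add_mem' := fun ha hb x₀ => (ha x₀).add (hb x₀)
  smul_mem' := fun c _ ha x₀ => (ha x₀).const_smul c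

variable (F M) in
/-- The space `Ω^k(M)` of smooth differential `k`-forms. -/
def Form (k : ℕ) : Type _ := smoothForms F M k

instance (k : ℕ) : AddCommGroup (Form F M k) := inferInstanceAs (AddCommGroup (smoothForms F M k))

instance (k : ℕ) : Module ℝ (Form F M k) := inferInstanceAs (Module ℝ (smoothForms F M k))

variable (F M) in
/-- Smooth vector fields. -/
abbrev VField [IsManifold 𝓘(ℝ, F) ∞ M] : Type _ := Cₛ^∞⟮𝓘(ℝ, F); F, (TangentSpace 𝓘(ℝ, F) : M → Type _)⟯

/-- The exterior derivative at `x`, computed in the chart at `x`. -/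
def extDerivForm {k : ℕ} (α : ∀ x : M, TangentSpace 𝓘(ℝ, F) x [⋀^Fin k]→L[ℝ] ℝ) (x : M) :
    TangentSpace 𝓘(ℝ, F) x [⋀^Fin (k + 1)]→L[ℝ] ℝ :=
  (extDeriv (coordRep α x) (extChartAt 𝓘(ℝ, F) x x)).compContinuousLinearMap
    (mfderiv 𝓘(ℝ, F) 𝓘(ℝ, F) (extChartAt 𝓘(ℝ, F) x) x)

/-- The interior product `(ι_X α)(v_1, …) = α (X, v_1, …)`. -/
def interiorForm {k : ℕ} (X : ∀ x : M, TangentSpace 𝓘(ℝ, F) x)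
    (α : ∀ x : M, TangentSpace 𝓘(ℝ, F) x [⋀^Fin (k + 1)]→L[ℝ] ℝ) (x : M) :
    TangentSpace 𝓘(ℝ, F) x [⋀^Fin k]→L[ℝ] ℝ :=
  ContinuousAlternatingMap.curryLeft (E := F) (α x) (X x)

/-! ### Cartan calculus on a normed space -/

/-- Insertion of the first argument, as a continuous linear map. -/
def curryL (k : ℕ) : (F [⋀^Fin (k + 1)]→L[ℝ] ℝ) →L[ℝ] (F →L[ℝ] F [⋀^Fin k]→L[ℝ] ℝ) :=
  (ContinuousAlternatingMap.curryLeftLI (𝕜 := ℝ) (E := F) (F := ℝ)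
    (n := k)).toContinuousLinearMap

theorem hasFDerivAt_curryLeft {k : ℕ} {α : F → F [⋀^Fin (k + 1)]→L[ℝ] ℝ} {y : F}
    (hα : DifferentiableAt ℝ α y) :
    HasFDerivAt (fun z => (α z).curryLeft) ((curryL k).comp (fderiv ℝ α y)) y := by
  have h := ContinuousLinearMap.hasFDerivAt (E := F [⋀^Fin (k + 1)]→L[ℝ] ℝ)
    (F := F →L[ℝ] F [⋀^Fin k]→L[ℝ] ℝ) (x := α y) (curryL k)
  exact HasFDerivAt.comp (𝕜 := ℝ) (E := F) (F := F [⋀^Fin (k + 1)]→L[ℝ] ℝ)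
    (G := F →L[ℝ] F [⋀^Fin k]→L[ℝ] ℝ) y h hα.hasFDerivAt

theorem hasFDerivAt_curry {k : ℕ} {α : F → F [⋀^Fin (k + 1)]→L[ℝ] ℝ} {v : F → F} {y : F}
    (hα : DifferentiableAt ℝ α y) (hv : DifferentiableAt ℝ v y) (h : F) :
    fderiv ℝ (fun z => (α z).curryLeft (v z)) y h =
      (fderiv ℝ α y h).curryLeft (v y) + (α y).curryLeft (fderiv ℝ v y h) := by
  have h1 := hasFDerivAt_curryLeft hα
  rw [(h1.clm_apply hv.hasFDerivAt).fderiv]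
  simp [curryL, add_comm]

theorem cartan {k : ℕ} {α : F → F [⋀^Fin (k + 1)]→L[ℝ] ℝ} {v : F → F} {y : F}
    (hα : DifferentiableAt ℝ α y) (hv : DifferentiableAt ℝ v y) (h : Fin (k + 1) → F) :
    extDeriv (fun z => (α z).curryLeft (v z)) y h + extDeriv α y (Matrix.vecCons (v y) h) =
      fderiv ℝ α y (v y) h + ∑ i : Fin (k + 1),
        (-1) ^ (i : ℕ) * α y (Matrix.vecCons (fderiv ℝ v y (h i)) (i.removeNth h)) := by
  simp only [extDeriv, ContinuousAlternatingMap.alternatizeUncurryFin_apply,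
    hasFDerivAt_curry hα hv]
  rw [Fin.sum_univ_succ (n := k + 1)]
  have e0 : (0 : Fin (k + 2)).removeNth (Matrix.vecCons (v y) h) = h := by
    funext i; simp [Fin.removeNth]
  have e1 : ∀ i : Fin (k + 1), (i.succ).removeNth (Matrix.vecCons (v y) h) =
      Matrix.vecCons (v y) (i.removeNth h) := by
    intro i; funext j
    refine Fin.cases ?_ (fun j => ?_) j <;> simp [Fin.removeNth]
  simp only [e0, e1]
  simp [pow_succ, Finset.sum_add_distrib]
  ring

theorem curry_swap {k : ℕ} (a : F [⋀^Fin (k + 2)]→L[ℝ] ℝ) (x y : F) (t : Fin k → F) :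
    a (Matrix.vecCons x (Matrix.vecCons y t)) = - a (Matrix.vecCons y (Matrix.vecCons x t)) := by
  have := a.toAlternatingMap.map_swap (Matrix.vecCons y (Matrix.vecCons x t))
    (i := 0) (j := 1) (by simp)
  rw [show Matrix.vecCons x (Matrix.vecCons y t) =
    (Matrix.vecCons y (Matrix.vecCons x t)) ∘ (Equiv.swap (0 : Fin (k + 2)) 1) from ?_]
  · exact this
  · funext i
    refine Fin.cases ?_ (fun i => ?_) i
    · simp
    · refine Fin.cases ?_ (fun i => ?_) i
      · simp
      · have : Equiv.swap (0 : Fin (k + 2)) 1 i.succ.succ = i.succ.succ :=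
          Equiv.swap_apply_of_ne_of_ne (by simp) (by simp [Fin.ext_iff])
        simp [this]

theorem extDeriv_curry_curry {k : ℕ} {α : F → F [⋀^Fin (k + 2)]→L[ℝ] ℝ} {v u : F → F} {y : F}
    (hα : DifferentiableAt ℝ α y) (hv : DifferentiableAt ℝ v y) (hu : DifferentiableAt ℝ u y)
    (h0 : extDeriv α y = 0) (h1 : extDeriv (fun z => (α z).curryLeft (v z)) y = 0)
    (h2 : extDeriv (fun z => (α z).curryLeft (u z)) y = 0) :
    extDeriv (fun z => ((α z).curryLeft (u z)).curryLeft (v z)) y =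
      (α y).curryLeft (VectorField.lieBracket ℝ v u y) := by
  ext h
  have hβ : DifferentiableAt ℝ (fun z => (α z).curryLeft (u z)) y := by
    have h1 := hasFDerivAt_curryLeft hα
    exact h1.differentiableAt.clm_apply hu
  have A := cartan hβ hv h
  have B := cartan hα hv (Matrix.vecCons (u y) h)
  rw [h2, hasFDerivAt_curry hα hu] at A
  rw [h0, h1, Fin.sum_univ_succ (n := k + 1)] at B
  have e0 : (0 : Fin (k + 2)).removeNth (Matrix.vecCons (u y) h) = h := by
    funext i; simp [Fin.removeNth]
  have e1 : ∀ i : Fin (k + 1), (i.succ).removeNth (Matrix.vecCons (u y) h) =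
      Matrix.vecCons (u y) (i.removeNth h) := by
    intro i; funext j
    refine Fin.cases ?_ (fun j => ?_) j <;> simp [Fin.removeNth]
  simp only [e0, e1, curry_swap (α y) _ (u y)] at B
  simp [pow_succ] at A B
  simp [VectorField.lieBracket, A]
  linarith
section
variable [IsManifold 𝓘(ℝ, F) ∞ M]


theorem two_le_infty : minSmoothness ℝ 2 ≤ (∞ : WithTop ℕ∞) := by
  rw [minSmoothness_of_isRCLikeNormedField]
  exact WithTop.coe_le_coe.2 (le_top : (2 : ℕ∞) ≤ ⊤)

theorem mdiffAt_symm {x₀ : M} {y : F} (hy : y ∈ (extChartAt 𝓘(ℝ, F) x₀).target) :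
    MDifferentiableAt 𝓘(ℝ, F) 𝓘(ℝ, F) (extChartAt 𝓘(ℝ, F) x₀).symm y := by
  have := mdifferentiableWithinAt_extChartAt_symm hy
  simpa [mdifferentiableWithinAt_univ] using this

theorem coordRep_comp_mfderiv {k : ℕ}
    (α : ∀ x : M, TangentSpace 𝓘(ℝ, F) x [⋀^Fin k]→L[ℝ] ℝ) (p z : M)
    (hz : z ∈ (extChartAt 𝓘(ℝ, F) p).source) :
    (coordRep α p (extChartAt 𝓘(ℝ, F) p z)).compContinuousLinearMap
      (mfderiv 𝓘(ℝ, F) 𝓘(ℝ, F) (extChartAt 𝓘(ℝ, F) p) z) = α z := by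
  have key : ∀ z' : M, z' = z → ∀ A B : F →L[ℝ] F, A.comp B = ContinuousLinearMap.id ℝ F →
      (ContinuousAlternatingMap.compContinuousLinearMap (M := F) (M' := F)
        (ContinuousAlternatingMap.compContinuousLinearMap (M := F) (M' := F) (α z') A) B)
        = (α z : F [⋀^Fin k]→L[ℝ] ℝ) := by
    rintro z' rfl A B h
    ext v
    change (α z') (fun i => (A.comp B) (v i)) = _
    rw [h]; rfl
  have h2 := mfderivWithin_extChartAt_symm_comp_mfderiv_extChartAt' (I := 𝓘(ℝ, F)) (x := p) hz
  simp only [modelWithCornersSelf_coe, range_id, mfderivWithin_univ] at h2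
  exact key _ ((extChartAt 𝓘(ℝ, F) p).left_inv hz) _ _ h2

/-- Change of coordinates from the chart at `x₀` to the chart at `p` -/
theorem coordRep_eq {k : ℕ} (α : ∀ x : M, TangentSpace 𝓘(ℝ, F) x [⋀^Fin k]→L[ℝ] ℝ)
    (x₀ p : M) (y : F) (hy : y ∈ (extChartAt 𝓘(ℝ, F) x₀).target)
    (hp : (extChartAt 𝓘(ℝ, F) x₀).symm y ∈ (extChartAt 𝓘(ℝ, F) p).source) :
    coordRep α x₀ y =
      (coordRep α p (extChartAt 𝓘(ℝ, F) p ((extChartAt 𝓘(ℝ, F) x₀).symm y))).compContinuousLinearMap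
        (fderiv ℝ (extChartAt 𝓘(ℝ, F) p ∘ (extChartAt 𝓘(ℝ, F) x₀).symm) y) := by
  have hψ : MDifferentiableAt 𝓘(ℝ, F) 𝓘(ℝ, F) (extChartAt 𝓘(ℝ, F) p)
      ((extChartAt 𝓘(ℝ, F) x₀).symm y) :=
    mdifferentiableAt_extChartAt (by rwa [← extChartAt_source 𝓘(ℝ, F)])
  have h1 := mfderiv_comp y hψ (mdiffAt_symm hy)
  rw [← mfderiv_eq_fderiv, h1]
  conv_lhs => rw [coordRep, ← coordRep_comp_mfderiv α p _ hp]
  rfl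

theorem coordRep_extDerivForm {k : ℕ} (α : Form F M k) (x₀ : M) (y : F)
    (hy : y ∈ (extChartAt 𝓘(ℝ, F) x₀).target) :
    coordRep (extDerivForm α.1) x₀ y = extDeriv (coordRep α.1 x₀) y := by
  set p := (extChartAt 𝓘(ℝ, F) x₀).symm y with hpdef
  set τ := extChartAt 𝓘(ℝ, F) p ∘ (extChartAt 𝓘(ℝ, F) x₀).symm with hτ
  have hp : p ∈ (extChartAt 𝓘(ℝ, F) p).source := mem_extChartAt_source p
  -- the set where the change of coordinates is defined
  have hU : ∀ᶠ z in 𝓝 y, z ∈ (extChartAt 𝓘(ℝ, F) x₀).target ∧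
      (extChartAt 𝓘(ℝ, F) x₀).symm z ∈ (extChartAt 𝓘(ℝ, F) p).source := by
    have h1 : (extChartAt 𝓘(ℝ, F) x₀).target ∈ 𝓝 y := (isOpen_extChartAt_target x₀).mem_nhds hy
    have h2 : ContinuousAt (extChartAt 𝓘(ℝ, F) x₀).symm y := continuousAt_extChartAt_symm'' hy
    exact (eventually_mem_set.2 h1).and
      (h2.eventually ((isOpen_extChartAt_source p).mem_nhds hp))
  have hev : coordRep α.1 x₀ =ᶠ[𝓝 y]
      fun z => (coordRep α.1 p (τ z)).compContinuousLinearMap (fderiv ℝ τ z) :=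
    hU.mono fun z hz => coordRep_eq α.1 x₀ p z hz.1 hz.2
  have hτs : ContDiffAt ℝ ∞ τ y := by
    have h1 : ContMDiffAt 𝓘(ℝ, F) 𝓘(ℝ, F) ∞ (extChartAt 𝓘(ℝ, F) p) p :=
      contMDiffAt_extChartAt
    have h2 : ContMDiffAt 𝓘(ℝ, F) 𝓘(ℝ, F) ∞ (extChartAt 𝓘(ℝ, F) x₀).symm y :=
      (contMDiffOn_extChartAt_symm x₀).contMDiffAt ((isOpen_extChartAt_target x₀).mem_nhds hy)
    exact (ContMDiffAt.comp y (by exact h1) h2).contDiffAt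
  have hz : τ y ∈ (extChartAt 𝓘(ℝ, F) p).target := (extChartAt 𝓘(ℝ, F) p).map_source hp
  have hd : DifferentiableAt ℝ (coordRep α.1 p) (τ y) :=
    ((α.2 p).contDiffAt ((isOpen_extChartAt_target p).mem_nhds hz)).differentiableAt (by simp)
  rw [hev.extDeriv_eq, extDeriv_pullback hd hτs two_le_infty]
  have hψ : MDifferentiableAt 𝓘(ℝ, F) 𝓘(ℝ, F) (extChartAt 𝓘(ℝ, F) p)
      ((extChartAt 𝓘(ℝ, F) x₀).symm y) :=
    mdifferentiableAt_extChartAt (mem_chart_source F p)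
  have h1 := mfderiv_comp y hψ (mdiffAt_symm hy)
  rw [← mfderiv_eq_fderiv, hτ, h1]
  rfl


theorem contDiffAt_coordRep {k : ℕ} (α : Form F M k) (x₀ : M) (y : F)
    (hy : y ∈ (extChartAt 𝓘(ℝ, F) x₀).target) : ContDiffAt ℝ ∞ (coordRep α.1 x₀) y :=
  (α.2 x₀).contDiffAt ((isOpen_extChartAt_target x₀).mem_nhds hy)

theorem extDerivForm_mem {k : ℕ} (α : Form F M k) :
    extDerivForm α.1 ∈ smoothForms F M (k + 1) := by
  intro x₀
  have h : ContDiffOn ℝ ∞ (extDeriv (coordRep α.1 x₀)) (extChartAt 𝓘(ℝ, F) x₀).target := by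
    have h1 : ContDiffOn ℝ ∞ (fderiv ℝ (coordRep α.1 x₀)) (extChartAt 𝓘(ℝ, F) x₀).target :=
      (α.2 x₀).fderiv_of_isOpen (isOpen_extChartAt_target x₀) (by simp)
    exact (ContinuousAlternatingMap.alternatizeUncurryFinCLM ℝ F ℝ).contDiff.comp_contDiffOn h1
  exact h.congr fun y hy => coordRep_extDerivForm α x₀ y hy

/-- The de Rham differential `Ω^k(M) → Ω^{k+1}(M)`. -/
def extD (k : ℕ) : Form F M k →ₗ[ℝ] Form F M (k + 1) where
  toFun α := ⟨extDerivForm α.1, extDerivForm_mem α⟩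
  map_add' α β := by
    apply Subtype.ext; funext x
    have ha := (contDiffAt_coordRep α x _ (mem_extChartAt_target x)).differentiableAt (by simp)
    have hb := (contDiffAt_coordRep β x _ (mem_extChartAt_target x)).differentiableAt (by simp)
    have h : coordRep (α + β).1 x = coordRep α.1 x + coordRep β.1 x := rfl
    change extDerivForm (α + β).1 x = extDerivForm α.1 x + extDerivForm β.1 x
    rw [extDerivForm, h, extDeriv_add ha hb]
    rfl
  map_smul' c α := by
    apply Subtype.ext; funext x
    have h : coordRep (c • α).1 x = c • coordRep α.1 x := rfl
    change extDerivForm (c • α).1 x = c • extDerivForm α.1 x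
    rw [extDerivForm, h, extDeriv_smul]
    rfl

theorem extD_extD {k : ℕ} (α : Form F M k) : extD (k + 1) (extD k α) = 0 := by
  apply Subtype.ext; funext x
  have hx := mem_extChartAt_target (I := 𝓘(ℝ, F)) x
  have h : coordRep (extD k α).1 x =ᶠ[𝓝 (extChartAt 𝓘(ℝ, F) x x)] extDeriv (coordRep α.1 x) := by
    filter_upwards [(isOpen_extChartAt_target x).mem_nhds hx] with y hy
      using coordRep_extDerivForm α x y hy
  change extDerivForm (extD k α).1 x = 0
  rw [extDerivForm, h.extDeriv_eq,
    extDeriv_extDeriv_apply (contDiffAt_coordRep α x _ hx) two_le_infty]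
  rfl

/-- The coordinate expression of a vector field. -/
def coordField (X : ∀ x : M, TangentSpace 𝓘(ℝ, F) x) (x₀ : M) : F → F :=
  VectorField.mpullback 𝓘(ℝ, F) 𝓘(ℝ, F) (extChartAt 𝓘(ℝ, F) x₀).symm X

theorem isInvertible_symm {x₀ : M} {y : F} (hy : y ∈ (extChartAt 𝓘(ℝ, F) x₀).target) :
    (mfderiv 𝓘(ℝ, F) 𝓘(ℝ, F) (extChartAt 𝓘(ℝ, F) x₀).symm y).IsInvertible := by
  have := isInvertible_mfderivWithin_extChartAt_symm (I := 𝓘(ℝ, F)) hy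
  simpa only [modelWithCornersSelf_coe, range_id, mfderivWithin_univ] using this

theorem mfderiv_coordField (X : ∀ x : M, TangentSpace 𝓘(ℝ, F) x) (x₀ : M) {y : F}
    (hy : y ∈ (extChartAt 𝓘(ℝ, F) x₀).target) :
    mfderiv 𝓘(ℝ, F) 𝓘(ℝ, F) (extChartAt 𝓘(ℝ, F) x₀).symm y (coordField (F := F) X x₀ y) =
      X ((extChartAt 𝓘(ℝ, F) x₀).symm y) := by
  obtain ⟨e, he⟩ := isInvertible_symm hy
  change mfderiv 𝓘(ℝ, F) 𝓘(ℝ, F) (extChartAt 𝓘(ℝ, F) x₀).symm y (ContinuousLinearMap.inverse _ _) = _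
  rw [← he, ContinuousLinearMap.inverse_equiv]
  exact e.apply_symm_apply _

theorem coordRep_interiorForm {k : ℕ} (X : ∀ x : M, TangentSpace 𝓘(ℝ, F) x)
    (α : ∀ x : M, TangentSpace 𝓘(ℝ, F) x [⋀^Fin (k + 1)]→L[ℝ] ℝ) (x₀ : M) {y : F}
    (hy : y ∈ (extChartAt 𝓘(ℝ, F) x₀).target) :
    coordRep (interiorForm X α) x₀ y = (coordRep α x₀ y).curryLeft (coordField X x₀ y) := by
  ext v
  change α _ (Matrix.vecCons (X _) fun i => mfderiv 𝓘(ℝ, F) 𝓘(ℝ, F) _ y (v i)) =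
    α _ (fun i => mfderiv 𝓘(ℝ, F) 𝓘(ℝ, F) _ y (Matrix.vecCons (coordField (F := F) X x₀ y) v i))
  congr 1
  funext i
  refine Fin.cases ?_ (fun i => ?_) i
  · exact (mfderiv_coordField X x₀ hy).symm
  · rfl

variable [FiniteDimensional ℝ F]

theorem contDiffAt_coordField (X : VField F M) (x₀ : M) {y : F}
    (hy : y ∈ (extChartAt 𝓘(ℝ, F) x₀).target) : ContDiffAt ℝ ∞ (coordField X x₀) y := by
  have h2 : ContMDiffAt 𝓘(ℝ, F) 𝓘(ℝ, F) ∞ (extChartAt 𝓘(ℝ, F) x₀).symm y :=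
    (contMDiffOn_extChartAt_symm x₀).contMDiffAt ((isOpen_extChartAt_target x₀).mem_nhds hy)
  have := FiniteDimensional.complete ℝ F
  have := ContMDiffAt.mpullback_vectorField_preimage (m := ∞) (n := ∞)
    (X.contMDiff ((extChartAt 𝓘(ℝ, F) x₀).symm y)) h2 (isInvertible_symm hy) (by simp)
  exact contMDiffAt_vectorSpace_iff_contDiffAt.1 this

theorem interiorForm_mem {k : ℕ} (X : VField F M) (α : Form F M (k + 1)) :
    interiorForm X α.1 ∈ smoothForms F M k := by
  intro x₀ y hy
  have h1 : ContDiffAt ℝ ∞ (fun z => (coordRep α.1 x₀ z).curryLeft) y :=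
    have hL := ContinuousLinearMap.contDiff (𝕜 := ℝ) (n := ∞) (E := F [⋀^Fin (k + 1)]→L[ℝ] ℝ)
      (F := F →L[ℝ] F [⋀^Fin k]→L[ℝ] ℝ) (curryL k)
    ContDiffAt.comp (𝕜 := ℝ) (E := F) (F := F [⋀^Fin (k + 1)]→L[ℝ] ℝ)
      (G := F →L[ℝ] F [⋀^Fin k]→L[ℝ] ℝ) y hL.contDiffAt (contDiffAt_coordRep α x₀ y hy)
  have h : ContDiffAt ℝ ∞
      (fun z => (coordRep α.1 x₀ z).curryLeft (coordField X x₀ z)) y :=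
    h1.clm_apply (contDiffAt_coordField X x₀ hy)
  refine (h.congr_of_eventuallyEq ?_).contDiffWithinAt
  filter_upwards [(isOpen_extChartAt_target x₀).mem_nhds hy] with z hz
    using coordRep_interiorForm _ _ x₀ hz

/-- The interior product `ι_X : Ω^{k+1}(M) → Ω^k(M)`, bilinear in `X` and the form. -/
def interior (k : ℕ) : VField F M →ₗ[ℝ] Form F M (k + 1) →ₗ[ℝ] Form F M k :=
  LinearMap.mk₂ ℝ (fun X α => ⟨interiorForm X α.1, interiorForm_mem X α⟩)
    (fun X Y α => by
      apply Subtype.ext; funext x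
      exact (ContinuousAlternatingMap.curryLeft (E := F) (α.1 x)).map_add (X x) (Y x))
    (fun c X α => by
      apply Subtype.ext; funext x
      exact (ContinuousAlternatingMap.curryLeft (E := F) (α.1 x)).map_smul c (X x))
    (fun X α β => rfl) (fun c X α => rfl)

instance : IsManifold 𝓘(ℝ, F) (minSmoothness ℝ 2) M := .of_le two_le_infty

/-- The Lie bracket of two smooth vector fields. -/
def lieField (X Y : VField F M) : VField F M where
  toFun := VectorField.mlieBracket 𝓘(ℝ, F) X Y
  contMDiff_toFun := by
    intro x
    have := FiniteDimensional.complete ℝ F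
    have : IsManifold 𝓘(ℝ, F) (((⊤ : ℕ∞) : WithTop ℕ∞) + 1) M := ‹IsManifold 𝓘(ℝ, F) ∞ M›
    exact ContMDiffAt.mlieBracket_vectorField (m := ⊤) (n := ⊤) (X.contMDiff x) (Y.contMDiff x)
      (by rw [minSmoothness_of_isRCLikeNormedField]; rfl)

theorem coordField_lieField (X Y : VField F M) (x₀ : M) {y : F}
    (hy : y ∈ (extChartAt 𝓘(ℝ, F) x₀).target) :
    coordField (lieField X Y) x₀ y =
      VectorField.lieBracket ℝ (coordField X x₀) (coordField Y x₀) y := by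
  have h2 : ContMDiffAt 𝓘(ℝ, F) 𝓘(ℝ, F) ∞ (extChartAt 𝓘(ℝ, F) x₀).symm y :=
    (contMDiffOn_extChartAt_symm x₀).contMDiffAt ((isOpen_extChartAt_target x₀).mem_nhds hy)
  have := FiniteDimensional.complete ℝ F
  have h := VectorField.mpullback_mlieBracket (n := ∞)
    (V := X) (W := Y) ((X.contMDiff _).mdifferentiableAt (by simp))
    ((Y.contMDiff _).mdifferentiableAt (by simp)) h2 two_le_infty
  refine h.trans ?_
  rw [← VectorField.mlieBracketWithin_univ, VectorField.mlieBracketWithin_eq_lieBracketWithin]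
  exact congrFun VectorField.lieBracketWithin_univ y

theorem extD_interior_interior {k : ℕ} (X Y : VField F M) (α : Form F M (k + 2))
    (h0 : extD (k + 2) α = 0) (hX : extD (k + 1) (interior (k + 1) X α) = 0)
    (hY : extD (k + 1) (interior (k + 1) Y α) = 0) :
    extD k (interior k X (interior (k + 1) Y α)) = interior (k + 1) (lieField X Y) α := by
  apply Subtype.ext; funext x
  have hx := mem_extChartAt_target (I := 𝓘(ℝ, F)) x
  have e : ∀ Z : VField F M, coordRep (interior (k + 1) Z α).1 x =ᶠ[𝓝 (extChartAt 𝓘(ℝ, F) x x)]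
      fun z => (coordRep α.1 x z).curryLeft (coordField Z x z) := fun Z => by
    filter_upwards [(isOpen_extChartAt_target x).mem_nhds hx] with y hy
      using coordRep_interiorForm _ _ x hy
  have e2 : coordRep (interior k X (interior (k + 1) Y α)).1 x =ᶠ[𝓝 (extChartAt 𝓘(ℝ, F) x x)]
      fun z => ((coordRep α.1 x z).curryLeft (coordField Y x z)).curryLeft (coordField X x z) := by
    filter_upwards [(isOpen_extChartAt_target x).mem_nhds hx] with y hy
    rw [← coordRep_interiorForm _ _ x hy]
    exact coordRep_interiorForm _ _ x hy
  have z : ∀ {j : ℕ} (β : Form F M j), extD j β = 0 →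
      extDeriv (coordRep β.1 x) (extChartAt 𝓘(ℝ, F) x x) = 0 := by
    intro j β hβ
    rw [← coordRep_extDerivForm β x _ hx]
    have : extDerivForm β.1 = 0 := congrArg Subtype.val hβ
    rw [this]; rfl
  have key := extDeriv_curry_curry
    ((contDiffAt_coordRep α x _ hx).differentiableAt (by simp))
    ((contDiffAt_coordField X x hx).differentiableAt (by simp))
    ((contDiffAt_coordField Y x hx).differentiableAt (by simp)) (z α h0)
    ((e X).extDeriv_eq.symm.trans (z _ hX)) ((e Y).extDeriv_eq.symm.trans (z _ hY))
  change extDerivForm _ x = interiorForm (lieField X Y) α.1 x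
  rw [extDerivForm, e2.extDeriv_eq, key, ← coordField_lieField X Y x hx,
    ← coordRep_interiorForm _ _ x hx]
  exact coordRep_comp_mfderiv _ x x (mem_extChartAt_source x)


/-! ### Forms of mixed degree -/

variable (F M) in
/-- `Ω^•(M)`: families of forms `(α_k)_k` with `α_k ∈ Ω^k(M)`. -/
abbrev Forms : Type _ := ∀ k : ℕ, Form F M k

variable (F M) in
/-- The forms that are homogeneous of degree `p`, i.e. `Ω^p(M)`, which is zero for `p < 0`. -/
def homog (p : ℤ) : Submodule ℝ (Forms F M) where
  carrier := {α | ∀ k : ℕ, (k : ℤ) ≠ p → α k = 0}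
  zero_mem' := fun _ _ => rfl
  add_mem' := fun ha hb k hk => by simp [ha k hk, hb k hk]
  smul_mem' := fun c α ha k hk => by simp [ha k hk]

variable (F M) in
/-- The de Rham differential on `Ω^•(M)`. -/
def d : Forms F M →ₗ[ℝ] Forms F M :=
  LinearMap.pi fun k => match k with
    | 0 => 0
    | k + 1 => extD k ∘ₗ LinearMap.proj k

/-- The interior product `ι_X` on `Ω^•(M)` (zero on `Ω^0(M)`), which depends linearly on `X`. -/
def ι : VField F M →ₗ[ℝ] Module.End ℝ (Forms F M) :=
  LinearMap.mk₂ ℝ (fun X α k => interior k X (α (k + 1)))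
    (fun X Y α => by funext k; simp) (fun c X α => by funext k; simp)
    (fun X α β => by funext k; simp) (fun c X α => by funext k; simp)

/-- The map `(X_1, …, X_k) ↦ ι_{X_1} ∘ ⋯ ∘ ι_{X_k}`. -/
def contraction (k : ℕ) :
    MultilinearMap ℝ (fun _ : Fin k => VField F M) (Module.End ℝ (Forms F M)) :=
  (MultilinearMap.mkPiAlgebraFin ℝ k (Module.End ℝ (Forms F M))).compLinearMap fun _ => ι

theorem d_mem_homog {p : ℤ} {α : Forms F M} (h : α ∈ homog F M p) : d F M α ∈ homog F M (p + 1) := by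
  intro k hk
  cases k with
  | zero => rfl
  | succ k =>
    change extD k (α k) = 0
    rw [h k (by push_cast at hk; omega), map_zero]

theorem ι_mem_homog {p : ℤ} {α : Forms F M} (X : VField F M) (h : α ∈ homog F M p) :
    ι X α ∈ homog F M (p - 1) := by
  intro k hk
  change interior k X (α (k + 1)) = 0
  rw [h (k + 1) (by push_cast; omega), map_zero]

theorem d_d (α : Forms F M) : d F M (d F M α) = 0 := by
  funext k
  match k with
  | 0 => rfl
  | 1 => exact map_zero (extD (F := F) (M := M) 0)
  | k + 2 => exact extD_extD (α k)

theorem contraction_mem_homog {p : ℤ} {α : Forms F M} (h : α ∈ homog F M p) :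
    ∀ (k : ℕ) (X : Fin k → VField F M), contraction k X α ∈ homog F M (p - k)
  | 0, X => by simpa [contraction] using h
  | k + 1, X => by
    have := ι_mem_homog (X 0) (contraction_mem_homog h k fun j => X j.succ)
    have e : contraction (k + 1) X α = ι (X 0) (contraction k (fun j => X j.succ) α) := by
      simp [contraction, List.ofFn_succ]
    rw [e]
    convert this using 2
    push_cast; ring

theorem single_mem_homog {k : ℕ} (α : Form F M k) : (Pi.single k α : Forms F M) ∈ homog F M k := by
  intro j hj
  exact Pi.single_eq_of_ne (by exact_mod_cast hj) α

/-! ### `n`-plectic manifolds -/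

variable (F M) in
/-- An `n`-plectic structure on `M`: a closed non-degenerate `(n+1)`-form. -/
structure NPlecticForm (n : ℕ) where
  form : Form F M (n + 1)
  closed : extD (n + 1) form = 0
  nondegenerate : ∀ (x : M) (v : TangentSpace 𝓘(ℝ, F) x),
    (∀ u : Fin n → TangentSpace 𝓘(ℝ, F) x, form.1 x (Fin.cons v u) = 0) → v = 0

variable {n : ℕ} (Ω : NPlecticForm F M n)

/-- The form `Ω` as an element of `Ω^•(M)`. -/
def NPlecticForm.toForms : Forms F M := Pi.single (n + 1) Ω.form

/-- The space of Hamiltonian forms: the `α ∈ Ω^{n-1}(M)` with `d α = - ι_χ Ω` for some smooth vector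
field `χ`. -/
def hamiltonianForms : Submodule ℝ (Forms F M) where
  carrier := {α | α ∈ homog F M ((n : ℤ) - 1) ∧ ∃ χ : VField F M, d F M α = - ι χ Ω.toForms}
  zero_mem' := ⟨zero_mem _, 0, by simp⟩
  add_mem' := by
    rintro α β ⟨ha, χ, h⟩ ⟨hb, χ', h'⟩
    exact ⟨add_mem ha hb, χ + χ', by simp [h, h', add_comm]⟩
  smul_mem' := by
    rintro c α ⟨ha, χ, h⟩
    exact ⟨Submodule.smul_mem _ c ha, c • χ, by simp [h]⟩

theorem d_ham_closed (χ : VField F M) {α : Forms F M} (h : d F M α = - ι χ Ω.toForms) :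
    extD n (interior n χ Ω.form) = 0 := by
  have h1 := congrFun (d_d α) (n + 1)
  rw [h] at h1
  have h2 : extD n (-(interior n χ (Ω.toForms (n + 1)))) = 0 := h1
  rw [NPlecticForm.toForms, Pi.single_eq_same, map_neg, neg_eq_zero] at h2
  exact h2

/-! ### The graded vector space of an `n`-plectic manifold and its brackets -/

/-- The components of the graded vector space: `E_{-1}` is the space of Hamiltonian forms,
`E_i = Ω^{n+i}(M)` for `-n ≤ i ≤ -2`, and `E_i = 0` otherwise. -/
def comp (i : ℤ) : Submodule ℝ (Forms F M) :=
  if i = -1 then hamiltonianForms Ω else if -(n : ℤ) ≤ i ∧ i ≤ -2 then homog F M (n + i) else ⊥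

/-- The graded vector space `E` of the `n`-plectic manifold `(M, Ω)`. -/
abbrev E (i : ℤ) : Type _ := comp Ω i

theorem comp_neg_one : comp Ω (-1) = hamiltonianForms Ω := if_pos rfl

theorem comp_le_neg_two {i : ℤ} (h : -(n : ℤ) ≤ i) (h' : i ≤ -2) : comp Ω i = homog F M (n + i) := by
  rw [comp, if_neg (by omega), if_pos ⟨h, h'⟩]

/-- By non-degeneracy a vector field `χ` is determined by `ι_χ Ω`. -/
theorem eq_of_ι_eq {χ χ' : VField F M} (h : ι χ Ω.toForms = ι χ' Ω.toForms) : χ = χ' := by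
  have h0 : interior n (χ - χ') Ω.form = 0 := by
    have h1 : interior n χ (Ω.toForms (n + 1)) = interior n χ' (Ω.toForms (n + 1)) := congrFun h n
    rw [NPlecticForm.toForms, Pi.single_eq_same] at h1
    rw [map_sub, LinearMap.sub_apply, h1, sub_self]
  ext x
  refine sub_eq_zero.1 (Ω.nondegenerate x (χ x - χ' x) fun u => ?_)
  exact congrArg (fun β : Form F M n => β.1 x u) h0

/-- The Hamiltonian vector field `χ_α` of `α ∈ E_{-1}`, determined by `d α = - ι_{χ_α} Ω`. -/
def hamField : E Ω (-1) →ₗ[ℝ] VField F M where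
  toFun α := (show α.1 ∈ hamiltonianForms Ω from comp_neg_one Ω ▸ α.2).2.choose
  map_add' α β := by
    have H := fun γ : E Ω (-1) =>
      (show γ.1 ∈ hamiltonianForms Ω from comp_neg_one Ω ▸ γ.2).2.choose_spec
    apply eq_of_ι_eq Ω
    rw [map_add, LinearMap.add_apply, ← neg_inj, neg_add, ← H α, ← H β, ← H (α + β), ← map_add]
    rfl
  map_smul' c α := by
    have H := fun γ : E Ω (-1) =>
      (show γ.1 ∈ hamiltonianForms Ω from comp_neg_one Ω ▸ γ.2).2.choose_spec
    apply eq_of_ι_eq Ω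
    rw [map_smul, LinearMap.smul_apply, ← neg_inj, RingHom.id_apply, ← smul_neg, ← H α, ← H (c • α),
      ← map_smul]
    rfl

theorem d_hamField (α : E Ω (-1)) : d F M α.1 = - ι (hamField Ω α) Ω.toForms :=
  (show α.1 ∈ hamiltonianForms Ω from comp_neg_one Ω ▸ α.2).2.choose_spec

theorem d_mem_comp {i : ℤ} (hi : i ≠ -1) (α : E Ω i) : d F M α.1 ∈ comp Ω (i + 1) := by
  obtain ⟨α, hα⟩ := α
  change d F M α ∈ comp Ω (i + 1)
  by_cases h : -(n : ℤ) ≤ i ∧ i ≤ -2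
  · rw [comp_le_neg_two Ω h.1 h.2] at hα
    have hd := d_mem_homog hα
    rw [add_assoc] at hd
    by_cases h2 : i = -2
    · subst h2
      rw [show (-2 : ℤ) + 1 = -1 from rfl, comp_neg_one]
      exact ⟨hd, 0, by rw [d_d, map_zero, LinearMap.zero_apply, neg_zero]⟩
    · rwa [comp_le_neg_two Ω (by omega) (by omega)]
  · rw [comp, if_neg hi, if_neg h, Submodule.mem_bot] at hα
    rw [hα, map_zero]
    exact zero_mem _

/-- The de Rham differential `E_i → E_{i+1}` for `i ≠ -1`, and zero for `i = -1`. -/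
def dComp (i : ℤ) : E Ω i →ₗ[ℝ] E Ω (i + 1) :=
  if hi : i = -1 then 0
  else (d F M ∘ₗ (comp Ω i).subtype).codRestrict (comp Ω (i + 1)) (d_mem_comp Ω hi)

/-- The de Rham differential on `E`, set to zero on `E_{-1}`. -/
def dE : (⨁ i, E Ω i) →ₗ[ℝ] ⨁ i, E Ω i :=
  DirectSum.toModule ℝ ℤ _ fun i => DirectSum.lof ℝ ℤ (E Ω) (i + 1) ∘ₗ dComp Ω i

/-- The unary bracket `l_1 α = s (-1)^{|α|} d α` for `|α| ≠ -1`, zero on `E_{-1}`; here `s = ±1` is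
a choice of sign. -/
def l1 (s : ℤˣ) : (⨁ i, E Ω i) →ₗ[ℝ] ⨁ i, E Ω i :=
  DirectSum.toModule ℝ ℤ _ fun i =>
    (s * i.negOnePow) • (DirectSum.lof ℝ ℤ (E Ω) (i + 1) ∘ₗ dComp Ω i)

/-- The map `(β_1, …, β_k) ↦ ι_{χ_{β_1}} ⋯ ι_{χ_{β_k}} θ` on Hamiltonian forms. -/
def hamContraction (θ : Forms F M) (k : ℕ) :
    MultilinearMap ℝ (fun _ : Fin k => E Ω (-1)) (Forms F M) :=
  (LinearMap.applyₗ θ : Module.End ℝ (Forms F M) →ₗ[ℝ] Forms F M).compMultilinearMap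
    ((contraction k).compLinearMap fun _ => hamField Ω)

/-- The `k`-linear map on `E` that is `ι_{χ_{β_1}} ⋯ ι_{χ_{β_k}} θ`, placed in `E_t`, on elements
`β_1, …, β_k` of `E_{-1}`, and zero if one of the arguments is homogeneous of another degree. -/
def hamBracket (θ : Forms F M) (k : ℕ) (t : ℤ) (h : ∀ β, hamContraction Ω θ k β ∈ comp Ω t) :
    KForm (E Ω) k :=
  (DirectSum.lof ℝ ℤ (E Ω) t).compMultilinearMap
    (((hamContraction Ω θ k).codRestrict (comp Ω t) h).compLinearMap fun _ =>
      DirectSum.component ℝ ℤ (E Ω) (-1))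

theorem hamContraction_toForms_mem {k : ℕ} (hk : k + 2 ≤ n + 1) (β : Fin (k + 2) → E Ω (-1)) :
    hamContraction Ω Ω.toForms (k + 2) β ∈ comp Ω (1 - ((k + 2 : ℕ) : ℤ)) := by
  have hom : hamContraction Ω Ω.toForms (k + 2) β ∈ homog F M (((n + 1 : ℕ) : ℤ) - (k + 2 : ℕ)) :=
    contraction_mem_homog (single_mem_homog Ω.form) (k + 2) fun j => hamField Ω (β j)
  by_cases h0 : k = 0
  · subst h0
    obtain ⟨m, rfl⟩ : ∃ m, n = m + 1 := ⟨n - 1, by omega⟩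
    refine (comp_neg_one Ω).ge (show hamContraction Ω Ω.toForms (0 + 2) β ∈ hamiltonianForms Ω from
      ⟨?_, lieField (hamField Ω (β 1)) (hamField Ω (β 0)), ?_⟩)
    · convert hom using 2
      push_cast; ring
    set X := hamField Ω (β 0)
    set Y := hamField Ω (β 1)
    have e : hamContraction Ω Ω.toForms (0 + 2) β = ι X (ι Y Ω.toForms) := by
      simp [hamContraction, contraction, List.ofFn_succ, X, Y]
    have swap : lieField Y X = - lieField X Y := by
      ext x
      exact VectorField.mlieBracket_swap_apply
    rw [e, swap, map_neg, LinearMap.neg_apply, neg_neg]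
    have key := extD_interior_interior X Y Ω.form Ω.closed
      (d_ham_closed Ω X (d_hamField Ω (β 0))) (d_ham_closed Ω Y (d_hamField Ω (β 1)))
    funext j
    by_cases hj : j = m + 1
    · subst hj
      change extD m (interior m X (interior (m + 1) Y (Ω.toForms (m + 2)))) =
        interior (m + 1) (lieField X Y) (Ω.toForms (m + 2))
      rw [NPlecticForm.toForms, Pi.single_eq_same]
      exact key
    · have z : Ω.toForms (j + 1) = 0 := Pi.single_eq_of_ne (by omega) _
      have hr : ι (lieField X Y) Ω.toForms j = 0 := by
        change interior j _ (Ω.toForms (j + 1)) = 0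
        rw [z, map_zero]
      rw [hr]
      cases j with
      | zero => rfl
      | succ j =>
        change extD j (interior j X (interior (j + 1) Y (Ω.toForms (j + 2)))) = 0
        rw [z, map_zero, map_zero, map_zero]
  · rw [comp_le_neg_two Ω (by omega) (by omega)]
    convert hom using 2
    push_cast; ring

/-- The sign `(-1)^{k/2+1}` for even `k`, and `(-1)^{(k-1)/2}` for odd `k`. -/
def bracketSign (k : ℕ) : ℤˣ := if Even k then (-1) ^ (k / 2 + 1) else (-1) ^ ((k - 1) / 2)

/-- The brackets `l_1, …, l_{n+1}` of the `n`-plectic manifold. For `k ≥ 2`, the bracket `l_k` is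
`bracketSign k` times `ι_{χ_{β_1}} ⋯ ι_{χ_{β_k}} Ω` on `E_{-1}`, and zero on other arguments. -/
def l (s : ℤˣ) : ∀ k : ℕ, KForm (E Ω) k
  | 0 => 0
  | 1 => MultilinearMap.ofSubsingleton ℝ _ _ (0 : Fin 1) (l1 Ω s)
  | k + 2 =>
    if hk : k + 2 ≤ n + 1 then bracketSign (k + 2) •
      hamBracket Ω Ω.toForms (k + 2) (1 - ((k + 2 : ℕ) : ℤ)) (hamContraction_toForms_mem Ω hk)
    else 0

/-- The structure `μ = l_1 + ⋯ + l_{n+1}`. -/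
def mu (s : ℤˣ) : VForm (E Ω) := ∑ k ∈ Finset.Icc 1 (n + 1), Pi.single k (l Ω s k)

theorem hamContraction_single_mem (η : Form F M n) {i : ℕ} (hi : 2 ≤ i ∧ i ≤ n)
    (β : Fin i → E Ω (-1)) :
    hamContraction Ω (Pi.single n η) i β ∈ comp Ω (-(i : ℤ)) := by
  rw [comp_le_neg_two Ω (by omega) (by omega)]
  exact contraction_mem_homog (single_mem_homog η) i fun j => hamField Ω (β j)

/-- The `i`-form `η̃_i(β_1, …, β_i) = ι_{χ_{β_1}} ⋯ ι_{χ_{β_i}} η` on Hamiltonian forms, extended by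
zero, for `2 ≤ i ≤ n`; it is zero for other `i`. -/
def etaTilde (η : Form F M n) (i : ℕ) : KForm (E Ω) i :=
  if hi : 2 ≤ i ∧ i ≤ n then
    hamBracket Ω (Pi.single n η) i (-(i : ℤ)) (hamContraction_single_mem Ω η hi)
  else 0

/-- The sum `η̃_2 + ⋯ + η̃_n`. -/
def etaSum (η : Form F M n) : VForm (E Ω) := ∑ i ∈ Finset.Icc 2 n, Pi.single i (etaTilde Ω η i)

/-- The deformed bracket `l_1`, resp. `l_i + s (-1)^i d ∘ η̃_i - ι_{l_2} η̃_{i-1}` for `i ≥ 2`. -/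
def deformed (s : ℤˣ) (η : Form F M n) (i : ℕ) : KForm (E Ω) i :=
  if i = 1 then l Ω s i
  else l Ω s i + (s * (-1) ^ i) • (dE Ω).compMultilinearMap (etaTilde Ω η i) -
    insertion (Pi.single 2 (l Ω s 2)) (Pi.single (i - 1) (etaTilde Ω η (i - 1))) i

end
end NPlectic
end

/-! Write `A` for the sum of the `η̃_i`, a form of degree `0`. Bracketing with the Euler map
multiplies a symmetric form by its degree (`rnBracket_euler`): in `[S, L]` the insertion of `S` into
`L` gives minus the sum of the argument degrees, composing `S` with `L` gives minus the degree of
the value, and the difference is the degree of `L`. Hence `[S, μ] = μ`, `[S, A] = 0` and `[S, [A,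
μ]] = [A, μ]`. For `N = S + A` and `K = S + 2A` this gives `[N, [N, μ]] = μ + 2[A, μ] + [A, [A, μ]]`
and `[K, μ] = μ + 2[A, μ]`, while `[N, K] = 0` because `[A, A] = 0` in degree `0`. Everything is
thus reduced to `[A, [A, μ]] = 0` (`isNijenhuisWithSquare_euler_add`).

This last identity is about Hamiltonian vector fields. The forms `l_k` with `k ≥ 2` and all `η̃_i`
see an argument only through the field of its component in `E_{-1}` (`hamBracket_eq_zero`). The
values of `η̃_i`, and of `l_k` for `k ≥ 3`, lie in degree at most `-2`, and a value of `l_1` in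
`E_{-1}` is closed; none of these has a field (`hamFieldE_etaTilde`, `hamFieldE_l1`). So in `[A, μ]`
only `l_1 ∘ η̃_i` and `ι_{l_2} η̃_i` survive (`rnBracket_etaTilde_l`), which is the asserted formula
for the deformed structure. That form vanishes as soon as one argument has zero field, and its own
values have zero field, so both insertions in `[A, [A, μ]]` are zero
(`rnBracket_rnBracket_etaTilde_l`).

The Euler argument needs `[A, μ]` to be graded symmetric, hence that insertion preserves graded
symmetry (`IsGradedSymmetric.insertion`). -/

namespace NPlectic

/-! ### Homogeneous tuples and the evaluation of insertions -/

section Graded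

open DirectSum

variable {E : ℤ → Type*} [∀ i, AddCommGroup (E i)] [∀ i, Module ℝ (E i)]

/-- The tuple `X` consists of homogeneous elements of degrees `a`. -/
def IsHomog {k : ℕ} (a : Fin k → ℤ) (X : Fin k → ⨁ i, E i) : Prop :=
  ∀ j, X j ∈ LinearMap.range (lof ℝ ℤ E (a j))

/-- Because homogeneity is a predicate on tuples and not a dependent family, reindexing and
prepending need no transport between the spaces `E i`. -/
theorem IsHomog.comp {k l : ℕ} {a : Fin k → ℤ} {X : Fin k → ⨁ i, E i} (h : IsHomog a X)
    (f : Fin l → Fin k) : IsHomog (a ∘ f) (X ∘ f) := fun j => h (f j)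

theorem IsHomog.cons {k : ℕ} {a : Fin k → ℤ} {X : Fin k → ⨁ i, E i} (h : IsHomog a X)
    {d : ℤ} {Y : ⨁ i, E i} (hY : Y ∈ LinearMap.range (lof ℝ ℤ E d)) :
    IsHomog (Fin.cons d a : Fin (k + 1) → ℤ) (Fin.cons Y X : Fin (k + 1) → ⨁ i, E i) :=
  Fin.cases hY h

theorem IsHomog.exists_of {k : ℕ} {a : Fin k → ℤ} {X : Fin k → ⨁ i, E i} (h : IsHomog a X) :
    ∃ x : ∀ j, E (a j), X = fun j => lof ℝ ℤ E (a j) (x j) := by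
  choose x hx using h
  exact ⟨x, funext fun j => (hx j).symm⟩

theorem HasDegree.mem {K : VForm E} {d : ℤ} (hK : HasDegree K d) {k : ℕ} {a : Fin k → ℤ}
    {X : Fin k → ⨁ i, E i} (h : IsHomog a X) :
    K k X ∈ LinearMap.range (lof ℝ ℤ E (∑ j, a j + d)) := by
  obtain ⟨x, rfl⟩ := h.exists_of
  exact hK k a x

theorem hasDegree_of_mem {K : VForm E} {d : ℤ}
    (h : ∀ (k : ℕ) (a : Fin k → ℤ) (X : Fin k → ⨁ i, E i), IsHomog a X →
      K k X ∈ LinearMap.range (lof ℝ ℤ E (∑ j, a j + d))) : HasDegree K d :=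
  fun k a x => h k a _ fun j => ⟨x j, rfl⟩

theorem IsGradedSymmetric.map_swap {K : VForm E} (hK : IsGradedSymmetric K) {k : ℕ}
    {a : Fin k → ℤ} {X : Fin k → ⨁ i, E i} (h : IsHomog a X) {p q : Fin k}
    (hpq : (q : ℕ) = p + 1) :
    K k (X ∘ Equiv.swap p q) = (a p * a q).negOnePow • K k X := by
  obtain ⟨x, rfl⟩ := h.exists_of
  exact hK k a x p q hpq

theorem isGradedSymmetric_of_map_swap {K : VForm E}
    (h : ∀ (k : ℕ) (a : Fin k → ℤ) (X : Fin k → ⨁ i, E i) (p q : Fin k), IsHomog a X →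
      (q : ℕ) = p + 1 → K k (X ∘ Equiv.swap p q) = (a p * a q).negOnePow • K k X) :
    IsGradedSymmetric K :=
  fun k a x p q hpq => h k a (fun j => lof ℝ ℤ E (a j) (x j)) p q (fun j => ⟨x j, rfl⟩) hpq

/-- By multilinearity homogeneous tuples suffice; only on these does the Koszul sign of a shuffle
have a meaning. -/
theorem VForm.ext_homog {K L : VForm E}
    (h : ∀ (k : ℕ) (a : Fin k → ℤ) (X : Fin k → ⨁ i, E i), IsHomog a X → K k X = L k X) :
    K = L := by
  funext k
  refine MultilinearMap.directSum_ext fun a => MultilinearMap.ext fun x => ?_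
  exact h k a _ fun j => ⟨x j, rfl⟩

/-- The value `L (K (X_s), X_{sᶜ})`, for a set `s` with `k` elements and complement of size `l`. -/
def insertValue (K L : VForm E) {m k l : ℕ} {s : Finset (Fin m)} (hk : s.card = k)
    (hl : sᶜ.card = l) (X : Fin m → ⨁ i, E i) : ⨁ i, E i :=
  L (l + 1) (Fin.cons (K k (X ∘ s.orderEmbOfFin hk)) (X ∘ sᶜ.orderEmbOfFin hl))

/-- The sizes of `s` and its complement enter only up to propositional equality, which allows the
enumerations of two different sets of equal size to be compared. -/
theorem insertValue_eq (K L : VForm E) {m k l : ℕ} {s : Finset (Fin m)} (hk : s.card = k)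
    (hl : sᶜ.card = l) (X : Fin m → ⨁ i, E i) :
    insertValue K L (s := s) rfl rfl X = insertValue K L hk hl X := by
  subst hk hl; rfl

theorem insertion_apply (K L : VForm E) {m : ℕ} {a : Fin m → ℤ} {X : Fin m → ⨁ i, E i}
    (h : IsHomog a X) :
    insertion K L m X = ∑ s : Finset (Fin m), koszulSign s a • insertValue K L (s := s) rfl rfl X := by
  obtain ⟨x, rfl⟩ := h.exists_of
  rw [insertion, _root_.sum_apply]
  refine Finset.sum_congr rfl fun s _ => ?_
  rw [MultilinearMap.fromDirectSumEquiv_lof]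
  rw [_root_.smul_apply, MultilinearMap.compLinearMap_apply]
  rfl

theorem insertion_add_left (K K' L : VForm E) :
    insertion (K + K') L = insertion K L + insertion K' L := by
  refine VForm.ext_homog fun m a X h => ?_
  simp only [Pi.add_apply, _root_.add_apply, insertion_apply _ _ h,
    ← Finset.sum_add_distrib, ← smul_add]
  refine Finset.sum_congr rfl fun s _ => congrArg _ ?_
  have := ((L (sᶜ.card + 1)).curryLeft.map_add (K _ (X ∘ s.orderEmbOfFin rfl))
    (K' _ (X ∘ s.orderEmbOfFin rfl)))
  exact congrArg (fun f => f (X ∘ sᶜ.orderEmbOfFin rfl)) this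

theorem insertion_add_right (K L L' : VForm E) :
    insertion K (L + L') = insertion K L + insertion K L' := by
  refine VForm.ext_homog fun m a X h => ?_
  simp only [Pi.add_apply, _root_.add_apply, insertion_apply _ _ h,
    ← Finset.sum_add_distrib, ← smul_add]
  rfl

theorem insertion_zero_right (K : VForm E) : insertion K 0 = 0 := by
  simpa using insertion_add_right K 0 0

theorem insertion_congr_left {K K' L : VForm E}
    (h : ∀ (k l : ℕ) (a : Fin k → ℤ) (X : Fin k → ⨁ i, E i) (Y : Fin l → ⨁ i, E i),
      IsHomog a X → L (l + 1) (Fin.cons (K k X) Y) = L (l + 1) (Fin.cons (K' k X) Y)) :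
    insertion K L = insertion K' L := by
  refine VForm.ext_homog fun m a X hX => ?_
  rw [insertion_apply _ _ hX, insertion_apply _ _ hX]
  exact Finset.sum_congr rfl fun s _ => congrArg _ (h _ _ _ _ _ (hX.comp (s.orderEmbOfFin rfl)))

theorem insertion_eq_zero {K L : VForm E}
    (h : ∀ (k l : ℕ) (a : Fin k → ℤ) (b : Fin l → ℤ) (X : Fin k → ⨁ i, E i)
      (Y : Fin l → ⨁ i, E i), IsHomog a X → IsHomog b Y →
        L (l + 1) (Fin.cons (K k X) Y) = 0) :
    insertion K L = 0 := by
  refine VForm.ext_homog fun m a X hX => ?_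
  rw [insertion_apply _ _ hX]
  exact Finset.sum_eq_zero fun s _ => by
    rw [insertValue, h _ _ _ _ _ _ (hX.comp (s.orderEmbOfFin rfl))
      (hX.comp (sᶜ.orderEmbOfFin rfl)), smul_zero]

theorem insertValue_single_eq_zero {k : ℕ} (K : KForm E k) (L : VForm E) {m : ℕ}
    {s : Finset (Fin m)} (hs : s.card ≠ k) (X : Fin m → ⨁ i, E i) :
    insertValue (Pi.single k K) L (s := s) rfl rfl X = 0 := by
  rw [insertValue, Pi.single_eq_of_ne hs, _root_.zero_apply]
  exact (L _).map_coord_zero 0 rfl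

/-- Only the `(i - 1)`-ary part of `L` contributes to the `i`-ary part of `ι_K L` for binary `K`. -/
theorem insertion_single_two_apply (K : KForm E 2) (L : VForm E) (i : ℕ) :
    insertion (Pi.single 2 K) (Pi.single (i - 1) (L (i - 1))) i =
      insertion (Pi.single 2 K) L i := by
  refine MultilinearMap.directSum_ext fun a => MultilinearMap.ext fun x => ?_
  have hX : IsHomog a fun j => lof ℝ ℤ E (a j) (x j) := fun j => ⟨x j, rfl⟩
  rw [MultilinearMap.compLinearMap_apply, MultilinearMap.compLinearMap_apply,
    insertion_apply _ _ hX, insertion_apply _ _ hX]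
  refine Finset.sum_congr rfl fun s _ => congrArg _ ?_
  by_cases hs : s.card = 2
  -- A subset with two elements forces `i ≥ 2`, so the subtraction is not truncated here.
  · have hc : sᶜ.card + 1 = i - 1 := by
      have h1 := s.card_le_univ
      rw [Fintype.card_fin] at h1
      rw [Finset.card_compl, Fintype.card_fin]
      omega
    rw [insertValue, insertValue, ← hc, Pi.single_eq_same]
  · rw [insertValue_single_eq_zero K _ hs, insertValue_single_eq_zero K _ hs]

theorem insertion_single_two_of_lt (K : KForm E 2) (L : VForm E) {i : ℕ} (hi : i < 2) :
    insertion (Pi.single 2 K) L i = 0 := by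
  refine MultilinearMap.directSum_ext fun a => MultilinearMap.ext fun x => ?_
  have hX : IsHomog a fun j => lof ℝ ℤ E (a j) (x j) := fun j => ⟨x j, rfl⟩
  rw [MultilinearMap.compLinearMap_apply, insertion_apply _ _ hX]
  refine Finset.sum_eq_zero fun s _ => ?_
  have h1 := s.card_le_univ
  rw [Fintype.card_fin] at h1
  rw [insertValue_single_eq_zero K L (by omega), smul_zero]

/-- Inserting `K` into a form `L` with one argument gives the composition `L ∘ K`. -/
theorem insertion_apply_of_unary {K L : VForm E} (hL : ∀ k, k ≠ 1 → L k = 0) {m : ℕ}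
    {a : Fin m → ℤ} {X : Fin m → ⨁ i, E i} (hX : IsHomog a X) :
    insertion K L m X = L 1 fun _ => K m X := by
  -- The value of `K` fills the only slot of `L`, so every argument must go into `K`.
  rw [insertion_apply _ _ hX, Finset.sum_eq_single Finset.univ]
  · have h1 : koszulSign Finset.univ a = 1 := by simp [koszulSign]
    rw [h1, one_smul]
    have hm : (Finset.univ : Finset (Fin m)).card = m := by simp
    rw [insertValue_eq K L hm (l := 0) (by simp), insertValue,
      ← Finset.orderEmbOfFin_unique hm (f := id) (by simp) strictMono_id]
    congr 1
    funext i
    obtain rfl : i = 0 := Subsingleton.elim (α := Fin 1) i 0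
    rfl
  · intro s _ hs
    have : sᶜ.card ≠ 0 := by
      rw [Ne, Finset.card_eq_zero, Finset.compl_eq_empty_iff]
      exact hs
    rw [insertValue, hL _ (by omega), _root_.zero_apply, smul_zero]
  · simp

/-! ### Degree and symmetry under the algebraic operations -/

theorem sum_orderEmbOfFin {m : ℕ} (s : Finset (Fin m)) (a : Fin m → ℤ) :
    ∑ j, a (s.orderEmbOfFin rfl j) + ∑ j, a (sᶜ.orderEmbOfFin rfl j) = ∑ j, a j := by
  rw [← Equiv.sum_comp (finSumEquivOfFinset (s := s) rfl rfl) a, Fintype.sum_sum_type]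
  simp

theorem range_lof_congr {i j : ℤ} (h : i = j) {x : ⨁ i, E i}
    (hx : x ∈ LinearMap.range (lof ℝ ℤ E i)) : x ∈ LinearMap.range (lof ℝ ℤ E j) := h ▸ hx

theorem units_smul_mem {p : Submodule ℝ (⨁ i, E i)} (u : ℤˣ) {x : ⨁ i, E i} (hx : x ∈ p) :
    u • x ∈ p := by
  rcases Int.units_eq_one_or u with rfl | rfl
  · simpa using hx
  · rw [Units.neg_smul, one_smul]
    exact neg_mem hx

theorem HasDegree.insertValue_mem {K L : VForm E} {d e : ℤ} (hK : HasDegree K d)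
    (hL : HasDegree L e) {m : ℕ} {a : Fin m → ℤ} {X : Fin m → ⨁ i, E i} (hX : IsHomog a X)
    (s : Finset (Fin m)) :
    insertValue K L (s := s) rfl rfl X ∈ LinearMap.range (lof ℝ ℤ E (∑ j, a j + (d + e))) := by
  have h1 := hK.mem (hX.comp (s.orderEmbOfFin rfl))
  have h2 := hL.mem ((hX.comp (sᶜ.orderEmbOfFin rfl)).cons h1)
  refine range_lof_congr ?_ h2
  rw [Fin.sum_univ_succ, ← sum_orderEmbOfFin s a]
  simp only [Fin.cons_zero, Fin.cons_succ, Function.comp_apply]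
  ring

theorem HasDegree.insertion {K L : VForm E} {d e : ℤ} (hK : HasDegree K d)
    (hL : HasDegree L e) : HasDegree (insertion K L) (d + e) := by
  refine hasDegree_of_mem fun m a X hX => ?_
  rw [insertion_apply _ _ hX]
  exact Submodule.sum_mem _ fun s _ => units_smul_mem _ (hK.insertValue_mem hL hX s)

theorem HasDegree.sub {K L : VForm E} {d : ℤ} (hK : HasDegree K d) (hL : HasDegree L d) :
    HasDegree (K - L) d := fun k a x => sub_mem (hK k a x) (hL k a x)

theorem HasDegree.add {K L : VForm E} {d : ℤ} (hK : HasDegree K d) (hL : HasDegree L d) :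
    HasDegree (K + L) d := fun k a x => add_mem (hK k a x) (hL k a x)

theorem HasDegree.smul {K : VForm E} {d : ℤ} (hK : HasDegree K d) (c : ℝ) :
    HasDegree (c • K) d := fun k a x => Submodule.smul_mem _ c (hK k a x)

theorem HasDegree.units_smul {K : VForm E} {d : ℤ} (hK : HasDegree K d) (u : ℤˣ) :
    HasDegree (u • K) d := fun k a x => units_smul_mem u (hK k a x)

theorem HasDegree.rnBracket {K L : VForm E} {d e : ℤ} (hK : HasDegree K d)
    (hL : HasDegree L e) : HasDegree (rnBracket d e K L) (d + e) :=
  (hK.insertion hL).sub ((add_comm e d ▸ hL.insertion hK).units_smul _)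

theorem IsGradedSymmetric.sub {K L : VForm E} (hK : IsGradedSymmetric K)
    (hL : IsGradedSymmetric L) : IsGradedSymmetric (K - L) := fun k a x p q h => by
  simp only [Pi.sub_apply, _root_.sub_apply, smul_sub, hK k a x p q h, hL k a x p q h]

theorem IsGradedSymmetric.add {K L : VForm E} (hK : IsGradedSymmetric K)
    (hL : IsGradedSymmetric L) : IsGradedSymmetric (K + L) := fun k a x p q h => by
  simp only [Pi.add_apply, _root_.add_apply, smul_add, hK k a x p q h, hL k a x p q h]

theorem IsGradedSymmetric.smul {K : VForm E} (hK : IsGradedSymmetric K) (c : ℝ) :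
    IsGradedSymmetric (c • K) := fun k a x p q h => by
  simp only [Pi.smul_apply, _root_.smul_apply, hK k a x p q h, smul_comm c]

theorem IsGradedSymmetric.units_smul {K : VForm E} (hK : IsGradedSymmetric K) (u : ℤˣ) :
    IsGradedSymmetric (u • K) := fun k a x p q h => by
  simp only [Pi.smul_apply, _root_.smul_apply, hK k a x p q h, smul_comm u]

/-! ### The Koszul sign and adjacent transpositions -/

/-- With the product running over all pairs, the membership conditions become part of the factors
and the product can be reindexed by a permutation. -/
theorem koszulSign_eq_prod {m : ℕ} (s : Finset (Fin m)) (a : Fin m → ℤ) :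
    koszulSign s a = ∏ i, ∏ j, if i ∈ s ∧ j ∉ s ∧ j < i then (a i * a j).negOnePow else 1 := by
  rw [koszulSign, ← Finset.prod_subset (Finset.subset_univ s)]
  · refine Finset.prod_congr rfl fun i hi => ?_
    rw [Finset.prod_filter, ← Finset.prod_subset (Finset.subset_univ sᶜ)]
    · refine Finset.prod_congr rfl fun j hj => ?_
      simp [hi, Finset.mem_compl.1 hj]
    · intro j _ hj
      simp at hj
      simp [hj]
  · intro i _ hi
    simp [hi]

theorem mem_map_swap {m : ℕ} (p q : Fin m) (s : Finset (Fin m)) (i : Fin m) :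
    i ∈ s.map (Equiv.swap p q).toEmbedding ↔ Equiv.swap p q i ∈ s := by
  rw [Finset.mem_map_equiv, Equiv.symm_swap]

theorem koszulSign_map_swap {m : ℕ} (s : Finset (Fin m)) (a : Fin m → ℤ) {p q : Fin m} :
    koszulSign (s.map (Equiv.swap p q).toEmbedding) (a ∘ Equiv.swap p q) =
      ∏ i, ∏ j, if i ∈ s ∧ j ∉ s ∧ Equiv.swap p q j < Equiv.swap p q i
        then (a i * a j).negOnePow else 1 := by
  rw [koszulSign_eq_prod, ← Equiv.prod_comp (Equiv.swap p q)]
  refine Finset.prod_congr rfl fun i _ => ?_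
  rw [← Equiv.prod_comp (Equiv.swap p q)]
  simp only [mem_map_swap, Function.comp_apply, Equiv.swap_apply_self]

/-- Nothing lies between two neighbours, so exchanging them reverses the order of no other pair. -/
theorem swap_lt_swap_iff {m : ℕ} {p q i j : Fin m} (hpq : (q : ℕ) = p + 1)
    (h1 : ¬(i = p ∧ j = q)) (h2 : ¬(i = q ∧ j = p)) :
    Equiv.swap p q j < Equiv.swap p q i ↔ j < i := by
  rw [Equiv.swap_apply_def, Equiv.swap_apply_def]
  simp only [Fin.ext_iff, Fin.lt_def] at *
  split_ifs <;> omega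

/-- The Koszul sign does not change if two neighbours on the same side are exchanged. -/
theorem koszulSign_swap_of_iff {m : ℕ} (s : Finset (Fin m)) (a : Fin m → ℤ) {p q : Fin m}
    (hpq : (q : ℕ) = p + 1) (h : p ∈ s ↔ q ∈ s) :
    koszulSign (s.map (Equiv.swap p q).toEmbedding) (a ∘ Equiv.swap p q) = koszulSign s a := by
  rw [koszulSign_map_swap, koszulSign_eq_prod]
  refine Finset.prod_congr rfl fun i _ => Finset.prod_congr rfl fun j _ => if_congr ?_ rfl rfl
  refine and_congr_right fun hi => and_congr_right fun hj => ?_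
  refine swap_lt_swap_iff hpq ?_ ?_
  · rintro ⟨rfl, rfl⟩; exact hj (h.1 hi)
  · rintro ⟨rfl, rfl⟩; exact hj (h.2 hi)

/-- In passing from `s` to its image exactly one inversion disappears, the pair of `q` in `s` and
`p` outside; every other pair keeps its order. -/
theorem koszulSign_swap_of_not_mem {m : ℕ} (s : Finset (Fin m)) (a : Fin m → ℤ) {p q : Fin m}
    (hpq : (q : ℕ) = p + 1) (hp : p ∉ s) (hq : q ∈ s) :
    koszulSign s a = (a p * a q).negOnePow *
      koszulSign (s.map (Equiv.swap p q).toEmbedding) (a ∘ Equiv.swap p q) := by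
  -- As a double product with one nontrivial factor, the extra sign can be compared factor by
  -- factor.
  have e : (a p * a q).negOnePow = ∏ i, ∏ j : Fin m, if i = q ∧ j = p then
      (a p * a q).negOnePow else 1 := by
    simp only [ite_and, Finset.prod_ite_eq', Finset.prod_ite_irrel, Finset.prod_const_one,
      Finset.mem_univ, if_true]
  rw [koszulSign_map_swap, koszulSign_eq_prod, e]
  simp only [← Finset.prod_mul_distrib]
  refine Finset.prod_congr rfl fun i _ => Finset.prod_congr rfl fun j _ => ?_
  by_cases h2 : i = q ∧ j = p
  · obtain ⟨rfl, rfl⟩ := h2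
    have h3 : j < i := Fin.lt_def.2 (by omega)
    simp [hp, hq, h3, h3.le, mul_comm]
  · rw [if_neg h2, one_mul]
    refine if_congr ?_ rfl rfl
    refine and_congr_right fun hi => and_congr_right fun hj => ?_
    refine (swap_lt_swap_iff hpq ?_ h2).symm
    rintro ⟨rfl, rfl⟩; exact hp hi

theorem koszulSign_swap_of_not_iff {m : ℕ} (s : Finset (Fin m)) (a : Fin m → ℤ) {p q : Fin m}
    (hpq : (q : ℕ) = p + 1) (h : ¬(p ∈ s ↔ q ∈ s)) :
    koszulSign (s.map (Equiv.swap p q).toEmbedding) (a ∘ Equiv.swap p q) =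
      (a p * a q).negOnePow * koszulSign s a := by
  by_cases hp : p ∈ s
  · have hq : q ∉ s := fun hq => h (iff_of_true hp hq)
    -- The swap is an involution: the previous lemma is applied to the image of `s`, where `p` and
    -- `q` have changed roles.
    rw [koszulSign_swap_of_not_mem _ _ hpq (by simpa using hq) (by simpa using hp)]
    congr 1
    · simp [mul_comm]
    · congr 1
      · ext i; simp
      · funext i; simp
  · have hq : q ∈ s := by tauto
    rw [koszulSign_swap_of_not_mem s a hpq hp hq, ← mul_assoc, Int.units_mul_self, one_mul]

/-! ### Order embeddings of subsets and adjacent transpositions -/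

theorem orderEmbOfFin_swap_of_mem {m k : ℕ} {s : Finset (Fin m)} (hk : s.card = k) {p q : Fin m}
    (hpq : (q : ℕ) = p + 1) (hp : p ∈ s) (hq : q ∈ s) :
    ∃ r r' : Fin k, (r' : ℕ) = r + 1 ∧ s.orderEmbOfFin hk r = p ∧ s.orderEmbOfFin hk r' = q ∧
      Equiv.swap p q ∘ s.orderEmbOfFin hk = s.orderEmbOfFin hk ∘ Equiv.swap r r' := by
  have hr : ∀ x ∈ s, ∃ r, s.orderEmbOfFin hk r = x := fun x hx => by
    have := s.range_orderEmbOfFin hk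
    rw [← Finset.mem_coe, ← this] at hx
    exact hx
  obtain ⟨r, rfl⟩ := hr p hp
  obtain ⟨r', rfl⟩ := hr q hq
  refine ⟨r, r', ?_, rfl, rfl, ?_⟩
  · have h1 : r < r' := (s.orderEmbOfFin hk).lt_iff_lt.1 (Fin.lt_def.2 (by omega))
    -- If the positions of `p` and `q` were not consecutive, some element of `s` would lie strictly
    -- between these neighbours.
    by_contra hne
    have hlt : (r : ℕ) + 1 < r' := by
      have := Fin.lt_def.1 h1
      omega
    have h2 : r < ⟨r + 1, by omega⟩ := Fin.lt_def.2 (by simp)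
    have h3 : (⟨r + 1, by omega⟩ : Fin k) < r' := Fin.lt_def.2 hlt
    have h4 := Fin.lt_def.1 ((s.orderEmbOfFin hk).lt_iff_lt.2 h2)
    have h5 := Fin.lt_def.1 ((s.orderEmbOfFin hk).lt_iff_lt.2 h3)
    omega
  · funext i
    exact (s.orderEmbOfFin hk).injective.swap_apply r r' i

theorem orderEmbOfFin_swap_of_not_mem {m k : ℕ} {s : Finset (Fin m)} (hk : s.card = k)
    {p q : Fin m} (hp : p ∉ s) (hq : q ∉ s) :
    Equiv.swap p q ∘ s.orderEmbOfFin hk = s.orderEmbOfFin hk := by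
  funext i
  have hi := s.orderEmbOfFin_mem hk i
  exact Equiv.swap_apply_of_ne_of_ne (fun e => hp (e ▸ hi)) (fun e => hq (e ▸ hi))

/-- As `p` and `q` are not both in `s`, the swap is increasing on `t`; the increasing enumeration of
`s` is unique. -/
theorem orderEmbOfFin_map_swap {m k : ℕ} {s t : Finset (Fin m)} {p q : Fin m}
    (hpq : (q : ℕ) = p + 1) (h : ¬(p ∈ s ∧ q ∈ s)) (ht : ∀ i, i ∈ t ↔ Equiv.swap p q i ∈ s)
    (hk : s.card = k) (hk' : t.card = k) :
    Equiv.swap p q ∘ t.orderEmbOfFin hk' = s.orderEmbOfFin hk := by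
  refine Finset.orderEmbOfFin_unique hk (fun x => (ht _).1 (t.orderEmbOfFin_mem hk' x)) ?_
  intro x y hxy
  have hlt := (t.orderEmbOfFin hk').lt_iff_lt.2 hxy
  have hx := (ht _).1 (t.orderEmbOfFin_mem hk' x)
  have hy := (ht _).1 (t.orderEmbOfFin_mem hk' y)
  refine (swap_lt_swap_iff hpq ?_ ?_).2 hlt <;>
  · rintro ⟨h1, h2⟩
    rw [h1] at hy; rw [h2] at hx
    simp only [Equiv.swap_apply_left, Equiv.swap_apply_right] at hx hy
    exact h (by tauto)

theorem map_swap_eq_self {m : ℕ} {s : Finset (Fin m)} {p q : Fin m} (h : p ∈ s ↔ q ∈ s) :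
    s.map (Equiv.swap p q).toEmbedding = s := by
  ext i
  rw [mem_map_swap, Equiv.swap_apply_def]
  split_ifs with h1 h2
  · rw [h1, h]
  · rw [h2, h]
  · rfl

/-! ### Graded symmetry of insertions and brackets -/

theorem cons_comp_swap {α : Type*} {k : ℕ} (x : α) (Y : Fin k → α) (r r' : Fin k) :
    (Fin.cons x (Y ∘ Equiv.swap r r') : Fin (k + 1) → α) =
      (Fin.cons x Y : Fin (k + 1) → α) ∘ Equiv.swap r.succ r'.succ := by
  funext i
  refine Fin.cases ?_ (fun i => ?_) i
  · rw [Function.comp_apply, Equiv.swap_apply_of_ne_of_ne (Fin.succ_ne_zero r).symm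
      (Fin.succ_ne_zero r').symm]
    rfl
  · rw [Function.comp_apply, (Fin.succ_injective k).swap_apply]
    rfl

theorem cons_smul (L : VForm E) {l : ℕ} (u : ℤˣ) (x : ⨁ i, E i) (Y : Fin l → ⨁ i, E i) :
    L (l + 1) (Fin.cons (u • x) Y) = u • L (l + 1) (Fin.cons x Y) := by
  rcases Int.units_eq_one_or u with rfl | rfl
  · simp
  · simp only [Units.neg_smul, one_smul]
    exact congrArg (fun f => f Y) ((L (l + 1)).curryLeft.map_neg x)

/-- This matches the shuffles of the swapped tuple with those of the original one, term by term. The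
sign comes from the symmetry of `K`, from the symmetry of `L` or from the Koszul sign, according to
the sides on which `p` and `q` lie. -/
theorem insertValue_swap {K L : VForm E} {d : ℤ} (hK : IsGradedSymmetric K) (hKd : HasDegree K d)
    (hL : IsGradedSymmetric L) {m : ℕ} {a : Fin m → ℤ} {X : Fin m → ⨁ i, E i} (hX : IsHomog a X)
    {p q : Fin m} (hpq : (q : ℕ) = p + 1) (s : Finset (Fin m)) :
    koszulSign (s.map (Equiv.swap p q).toEmbedding) (a ∘ Equiv.swap p q) •
      insertValue K L (s := s.map (Equiv.swap p q).toEmbedding) rfl rfl (X ∘ Equiv.swap p q) =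
    (a p * a q).negOnePow • koszulSign s a • insertValue K L (s := s) rfl rfl X := by
  by_cases h : p ∈ s ↔ q ∈ s
  · rw [koszulSign_swap_of_iff s a hpq h, smul_comm, map_swap_eq_self h]
    congr 1
    by_cases hp : p ∈ s
    -- Both neighbours are arguments of `K`, in consecutive positions.
    · have hq := h.1 hp
      obtain ⟨r, r', hr, h1, h2, h3⟩ := orderEmbOfFin_swap_of_mem (s := s) rfl hpq hp hq
      rw [insertValue, Function.comp_assoc, Function.comp_assoc, h3,
        orderEmbOfFin_swap_of_not_mem (s := sᶜ) rfl (by simpa using hp) (by simpa using hq),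
        ← Function.comp_assoc, hK.map_swap (hX.comp _) hr, cons_smul, Function.comp_apply,
        Function.comp_apply, h1, h2]
      rfl
    -- Both neighbours are direct arguments of `L`. The degree of `K` makes the first argument of
    -- `L` homogeneous, as its symmetry requires.
    · have hq := fun hq => hp (h.2 hq)
      obtain ⟨r, r', hr, h1, h2, h3⟩ := orderEmbOfFin_swap_of_mem (s := sᶜ) rfl hpq
        (by simpa using hp) (by simpa using hq)
      have hh := (hX.comp (sᶜ.orderEmbOfFin rfl)).cons (hKd.mem (hX.comp (s.orderEmbOfFin rfl)))
      rw [insertValue, Function.comp_assoc, Function.comp_assoc, h3,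
        orderEmbOfFin_swap_of_not_mem (s := s) rfl hp hq, ← Function.comp_assoc, cons_comp_swap,
        hL.map_swap hh (by simp [hr]), Fin.cons_succ, Fin.cons_succ, Function.comp_apply,
        Function.comp_apply, h1, h2]
      rfl
  -- The neighbours are on different sides: `K` and `L` receive the same tuples as before, and the
  -- sign is entirely the Koszul sign.
  · rw [koszulSign_swap_of_not_iff s a hpq h, mul_smul]
    congr 2
    have hc : (s.map (Equiv.swap p q).toEmbedding).card = s.card := Finset.card_map _
    have hc' : (s.map (Equiv.swap p q).toEmbedding)ᶜ.card = sᶜ.card := by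
      rw [Finset.card_compl, Finset.card_compl, hc]
    rw [insertValue_eq K L hc hc', insertValue, insertValue, Function.comp_assoc,
      Function.comp_assoc, orderEmbOfFin_map_swap (s := s) hpq (by tauto)
        (fun i => mem_map_swap p q s i) rfl,
      orderEmbOfFin_map_swap (s := sᶜ) hpq (by simp only [Finset.mem_compl]; tauto)
        (fun i => by simp only [Finset.mem_compl, mem_map_swap]) rfl]

theorem IsGradedSymmetric.insertion {K L : VForm E} {d : ℤ} (hK : IsGradedSymmetric K)
    (hKd : HasDegree K d) (hL : IsGradedSymmetric L) : IsGradedSymmetric (insertion K L) := by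
  refine isGradedSymmetric_of_map_swap fun m a X p q hX hpq => ?_
  rw [insertion_apply _ _ hX, insertion_apply _ _ (hX.comp (Equiv.swap p q)), Finset.smul_sum,
    ← Equiv.sum_comp (Equiv.finsetCongr (Equiv.swap p q))]
  exact Finset.sum_congr rfl fun s _ => insertValue_swap hK hKd hL hX hpq s

theorem IsGradedSymmetric.rnBracket {K L : VForm E} {d e : ℤ} (hK : IsGradedSymmetric K)
    (hKd : HasDegree K d) (hL : IsGradedSymmetric L) (hLd : HasDegree L e) :
    IsGradedSymmetric (rnBracket d e K L) :=
  (hK.insertion hKd hL).sub ((hL.insertion hLd hK).units_smul _)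

/-! ### The Euler map -/

theorem euler_of_ne {k : ℕ} (hk : k ≠ 1) : euler E k = 0 := Pi.single_eq_of_ne hk _

theorem euler_one_apply {a : ℤ} {x : ⨁ i, E i} (hx : x ∈ LinearMap.range (lof ℝ ℤ E a)) :
    euler E 1 (fun _ => x) = (-(a : ℝ)) • x := by
  obtain ⟨x, rfl⟩ := hx
  rw [euler, Pi.single_eq_same, MultilinearMap.ofSubsingleton_apply_apply, toModule_lof]
  rfl

theorem hasDegree_euler : HasDegree (euler E) 0 := by
  refine hasDegree_of_mem fun k a X hX => ?_
  by_cases hk : k = 1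
  · subst hk
    have : X = fun _ => X 0 := funext fun i => congrArg X (Subsingleton.elim _ _)
    rw [this, euler_one_apply (hX 0)]
    exact range_lof_congr (by simp) (Submodule.smul_mem _ (-(a 0 : ℝ)) (hX 0))
  · rw [euler_of_ne hk]
    exact zero_mem _

theorem isGradedSymmetric_of_unary {K : VForm E} (hK : ∀ k, k ≠ 1 → K k = 0) :
    IsGradedSymmetric K := by
  intro k a x p q hpq
  rw [hK k (by have := p.isLt; have := q.isLt; omega)]
  simp

theorem isGradedSymmetric_euler : IsGradedSymmetric (euler E) :=
  isGradedSymmetric_of_unary fun _ hk => euler_of_ne hk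

theorem koszulSign_zero {m : ℕ} (a : Fin (m + 1) → ℤ) : koszulSign {0} a = 1 := by
  simp [koszulSign]

/-- Moving the argument `X j` to the front passes all earlier arguments, one neighbour at a time,
and the collected signs form the Koszul sign of `{j}`. -/
theorem IsGradedSymmetric.cons_removeNth {L : VForm E} (hL : IsGradedSymmetric L) {m : ℕ}
    (j : Fin (m + 1)) : ∀ {a : Fin (m + 1) → ℤ} {X : Fin (m + 1) → ⨁ i, E i}, IsHomog a X →
      koszulSign {j} a • L (m + 1) (Fin.cons (X j) (X ∘ j.succAbove)) = L (m + 1) X := by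
  induction j using Fin.induction with
  | zero =>
    intro a X hX
    rw [koszulSign_zero, one_smul]
    congr 1
    funext i
    refine Fin.cases rfl (fun i => ?_) i
    simp
  | succ j ih =>
    intro a X hX
    have hpq : (j.succ : ℕ) = j.castSucc + 1 := by simp
    -- After the swap, the entry to be moved stands one place further left.
    have h1 := ih (hX.comp (Equiv.swap j.castSucc j.succ))
    have hne : j.castSucc ≠ j.succ := (Fin.castSucc_lt_succ).ne
    have hs := koszulSign_swap_of_not_mem {j.succ} a hpq (by simpa using hne) (by simp)
    rw [Finset.map_singleton, Equiv.coe_toEmbedding, Equiv.swap_apply_right] at hs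
    rw [hL.map_swap hX hpq] at h1
    have e : (X ∘ Equiv.swap j.castSucc j.succ) ∘ j.castSucc.succAbove =
        X ∘ j.succ.succAbove := by
      funext i
      simp only [Function.comp_apply]
      congr 1
      rw [Equiv.swap_apply_def]
      simp only [Fin.succAbove, Fin.lt_def, Fin.ext_iff, Fin.val_castSucc, Fin.val_succ]
      split_ifs <;> simp_all <;> omega
    rw [e, Function.comp_apply, Equiv.swap_apply_left] at h1
    rw [hs, mul_smul, h1, smul_smul, Int.units_mul_self, one_smul]

/-- Only singletons `{j}` contribute. Each yields the factor `-|X_j|`, and by graded symmetry the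
Koszul sign cancels the move of `X_j` to the front. -/
theorem insertion_euler_left {L : VForm E} (hL : IsGradedSymmetric L) {m : ℕ} {a : Fin m → ℤ}
    {X : Fin m → ⨁ i, E i} (hX : IsHomog a X) :
    insertion (euler E) L m X = (-((∑ j, a j : ℤ) : ℝ)) • L m X := by
  rw [insertion_apply _ _ hX, ← Finset.sum_subset (Finset.subset_univ (Finset.powersetCard 1 _)),
    Finset.powersetCard_one, Finset.sum_map]
  · rw [Int.cast_sum, ← Finset.sum_neg_distrib, Finset.sum_smul]
    refine Finset.sum_congr rfl fun j _ => ?_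
    obtain ⟨m, rfl⟩ : ∃ m', m = m' + 1 := ⟨m - 1, by have := j.isLt; omega⟩
    have hc : ({j} : Finset (Fin (m + 1))).card = 1 := Finset.card_singleton j
    have hc' : ({j} : Finset (Fin (m + 1)))ᶜ.card = m := by
      rw [Finset.card_compl, hc, Fintype.card_fin]; rfl
    change koszulSign {j} a • insertValue (euler E) L (s := {j}) rfl rfl X = _
    rw [insertValue_eq _ _ hc hc', insertValue]
    have e1 : X ∘ Finset.orderEmbOfFin {j} hc = fun _ => X j := by
      funext i; simp
    have e2 : X ∘ Finset.orderEmbOfFin {j}ᶜ hc' = X ∘ j.succAbove := by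
      funext i; simp
    rw [e1, e2, euler_one_apply (hX j), ← hL.cons_removeNth j hX, smul_comm]
    congr 1
    exact congrArg (fun f => f (X ∘ j.succAbove))
      ((L (m + 1)).curryLeft.map_smul (-(a j : ℝ)) (X j))
  · intro s _ hs
    rw [insertValue, euler_of_ne (by simpa using hs)]
    have := congrArg (fun f => f (X ∘ sᶜ.orderEmbOfFin rfl)) (L (sᶜ.card + 1)).curryLeft.map_zero
    rw [_root_.zero_apply, ← MultilinearMap.curryLeft_apply, this]
    simp

/-- The Euler map acts on forms by their degree. -/
theorem rnBracket_euler {L : VForm E} {d : ℤ} (hL : IsGradedSymmetric L) (hLd : HasDegree L d) :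
    rnBracket 0 d (euler E) L = (d : ℝ) • L := by
  refine VForm.ext_homog fun m a X hX => ?_
  rw [rnBracket, zero_mul, Int.negOnePow_zero, one_smul, Pi.sub_apply, _root_.sub_apply,
    insertion_euler_left hL hX, insertion_apply_of_unary (fun _ hk => euler_of_ne hk) hX,
    euler_one_apply (hLd.mem hX), ← sub_smul, Pi.smul_apply, _root_.smul_apply]
  congr 1
  push_cast
  ring

/-! ### Reduction of the Nijenhuis condition -/

theorem rnBracket_zero_add_left (e : ℤ) (K K' L : VForm E) :
    rnBracket 0 e (K + K') L = rnBracket 0 e K L + rnBracket 0 e K' L := by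
  simp only [rnBracket, zero_mul, Int.negOnePow_zero, one_smul, insertion_add_left,
    insertion_add_right]
  abel

theorem rnBracket_zero_add_right (e : ℤ) (K L L' : VForm E) :
    rnBracket 0 e K (L + L') = rnBracket 0 e K L + rnBracket 0 e K L' := by
  simp only [rnBracket, zero_mul, Int.negOnePow_zero, one_smul, insertion_add_left,
    insertion_add_right]
  abel

/-- If `A` has degree zero and `[A, [A, μ]] = 0`, then `S + A` is Nijenhuis with square
`S + 2 A`. -/
theorem isNijenhuisWithSquare_euler_add {μ A : VForm E} (hμ : IsGradedSymmetric μ)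
    (hμd : HasDegree μ 1) (hA : IsGradedSymmetric A) (hAd : HasDegree A 0)
    (h : rnBracket 0 1 A (rnBracket 0 1 A μ) = 0) :
    IsNijenhuisWithSquare μ (euler E + A) (euler E + (2 : ℝ) • A) where
  symm_structure := hμ
  degree_structure := hμd
  symm_form := isGradedSymmetric_euler.add hA
  degree_form := hasDegree_euler.add hAd
  symm_square := isGradedSymmetric_euler.add (hA.smul 2)
  degree_square := hasDegree_euler.add (hAd.smul 2)
  deform_deform := by
    have hB := hA.rnBracket hAd hμ hμd
    have hBd : HasDegree (rnBracket 0 1 A μ) 1 := hAd.rnBracket hμd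
    -- The Euler map fixes `μ` and `[A, μ]`, both of degree `1`; each side becomes `μ + 2[A, μ]`.
    simp only [rnBracket_zero_add_left, rnBracket_zero_add_right,
      rnBracket_euler hμ hμd, Int.cast_one, one_smul, h, rnBracket_euler hB hBd, two_smul]
    abel
  commute := by
    have h1 : rnBracket 0 0 (euler E) A = 0 := by
      rw [rnBracket_euler hA hAd, Int.cast_zero, zero_smul]
    -- In degree `0` the bracket is antisymmetric.
    have h2 : rnBracket 0 0 A (euler E) = 0 := by
      rw [rnBracket, zero_mul, Int.negOnePow_zero, one_smul] at h1 ⊢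
      rw [← neg_sub, h1, neg_zero]
    have h3 : rnBracket 0 0 (euler E) (euler E) = 0 := by simp [rnBracket]
    have h4 : rnBracket 0 0 A A = 0 := by simp [rnBracket]
    simp only [two_smul, rnBracket_zero_add_left, rnBracket_zero_add_right, h1, h2, h3, h4,
      add_zero]

end Graded

end NPlectic
noncomputable section
namespace NPlectic

/-! ### The brackets of an `n`-plectic manifold -/

section

open DirectSum

variable {F : Type*} [NormedAddCommGroup F] [NormedSpace ℝ F] [FiniteDimensional ℝ F]
  {M : Type*} [TopologicalSpace M] [ChartedSpace F M] [IsManifold 𝓘(ℝ, F) ∞ M]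

theorem ι_ι_swap (X Y : VField F M) (α : Forms F M) : ι X (ι Y α) = -ι Y (ι X α) := by
  funext k
  apply Subtype.ext; funext x
  ext v
  exact curry_swap (F := F) (α (k + 2) |>.1 x) (Y x) (X x) v

theorem contraction_succ {k : ℕ} (X : Fin (k + 1) → VField F M) (α : Forms F M) :
    contraction (k + 1) X α = ι (X 0) (contraction k (fun j => X j.succ) α) := by
  simp [contraction, List.ofFn_succ]

/-- Two interior products anticommute. A transposition of the first two fields is this fact; any
other one takes place inside the inner contraction. -/
theorem contraction_swap (α : Forms F M) : ∀ {k : ℕ} (X : Fin k → VField F M) {p q : Fin k},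
    (q : ℕ) = p + 1 → contraction k (X ∘ Equiv.swap p q) α = -contraction k X α
  | 0, _, p, _, _ => p.elim0
  | k + 1, X, p, q, hpq => by
    obtain ⟨q, rfl⟩ : ∃ q', q = Fin.succ q' := by
      refine ⟨q.pred fun h => ?_, (Fin.succ_pred _ _).symm⟩
      rw [h, Fin.val_zero] at hpq
      omega
    induction p using Fin.cases with
    | zero =>
      obtain ⟨k, rfl⟩ : ∃ k', k = k' + 1 := ⟨k - 1, by have := q.isLt; omega⟩
      obtain rfl : q = 0 := Fin.ext (by simpa using hpq)
      have h : ∀ j : Fin k, Equiv.swap (0 : Fin (k + 2)) (Fin.succ 0) j.succ.succ = j.succ.succ :=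
        fun j => Equiv.swap_apply_of_ne_of_ne (Fin.succ_ne_zero _)
          fun h => Fin.succ_ne_zero _ (Fin.succ_injective _ h)
      simp only [contraction_succ, Function.comp_apply, Equiv.swap_apply_left,
        Equiv.swap_apply_right, h]
      exact ι_ι_swap _ _ _
    | succ p =>
      have h0 : Equiv.swap p.succ q.succ 0 = 0 :=
        Equiv.swap_apply_of_ne_of_ne (Fin.succ_ne_zero _).symm (Fin.succ_ne_zero _).symm
      have ih := contraction_swap α (fun j => X j.succ) (p := p) (q := q) (by simpa using hpq)
      rw [contraction_succ, contraction_succ, ← map_neg, ← ih]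
      simp only [Function.comp_apply, h0, (Fin.succ_injective k).swap_apply]
      rfl

theorem sum_pi_single {β : ℕ → Type*} [∀ k, AddCommMonoid (β k)] (t : Finset ℕ) (f : ∀ k, β k)
    (h : ∀ k, k ∉ t → f k = 0) : ∑ k ∈ t, Pi.single k (f k) = f := by
  funext k
  rw [Finset.sum_apply]
  by_cases hk : k ∈ t
  · rw [Finset.sum_eq_single_of_mem k hk fun j _ hj => Pi.single_eq_of_ne hj.symm _,
      Pi.single_eq_same]
  · rw [h k hk]
    exact Finset.sum_eq_zero fun j hj => Pi.single_eq_of_ne (ne_of_mem_of_not_mem hj hk).symm _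

/-! ### Arguments without Hamiltonian vector field -/

variable {n : ℕ} (Ω : NPlecticForm F M n)

theorem hamField_eq_zero {α : E Ω (-1)} (h : d F M α.1 = 0) : hamField Ω α = 0 := by
  refine eq_of_ι_eq Ω ?_
  rw [map_zero, LinearMap.zero_apply, ← neg_eq_zero, ← d_hamField, h]

/-- The Hamiltonian vector field of the component of degree `-1`. -/
def hamFieldE : (⨁ i, E Ω i) →ₗ[ℝ] VField F M := hamField Ω ∘ₗ component ℝ ℤ (E Ω) (-1)

theorem hamFieldE_eq_zero {i : ℤ} (hi : i ≠ -1) {x : ⨁ i, E Ω i}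
    (hx : x ∈ LinearMap.range (lof ℝ ℤ (E Ω) i)) : hamFieldE Ω x = 0 := by
  obtain ⟨x, rfl⟩ := hx
  rw [hamFieldE, LinearMap.comp_apply, component.of, dif_neg hi, map_zero]

/-- Only `l_1` on `E_{-2}` reaches `E_{-1}`. Its values are exact, hence closed, and non-degeneracy
makes their field zero. -/
theorem hamFieldE_l1 (s : ℤˣ) (x : ⨁ i, E Ω i) : hamFieldE Ω (l1 Ω s x) = 0 := by
  have : hamFieldE Ω ∘ₗ l1 Ω s = 0 := by
    refine linearMap_ext ℝ fun i => LinearMap.ext fun α => ?_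
    have h : hamFieldE Ω (lof ℝ ℤ (E Ω) (i + 1) (dComp Ω i α)) = 0 := by
      by_cases hi : i = -2
      · subst hi
        change hamField Ω (component ℝ ℤ (E Ω) (-1) (lof ℝ ℤ (E Ω) (-1) (dComp Ω (-2) α))) = 0
        rw [component.lof_self]
        refine hamField_eq_zero Ω ?_
        rw [dComp, dif_neg (by norm_num)]
        exact d_d α.1
      · exact hamFieldE_eq_zero Ω (by omega) ⟨_, rfl⟩
    rw [LinearMap.comp_apply, LinearMap.comp_apply, l1, toModule_lof]
    rcases Int.units_eq_one_or (s * i.negOnePow) with hu | hu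
    · simpa [hu] using h
    · simpa [hu] using h
  exact congrArg (fun f => f x) this

/-! ### Forms that depend only on Hamiltonian vector fields -/

section hamBracket

variable {Ω} {θ : Forms F M} {k : ℕ} {t : ℤ} {h : ∀ β, hamContraction Ω θ k β ∈ comp Ω t}

theorem hamBracket_mem (X : Fin k → ⨁ i, E Ω i) :
    hamBracket Ω θ k t h X ∈ LinearMap.range (lof ℝ ℤ (E Ω) t) := ⟨_, rfl⟩

/-- The contraction is multilinear in the fields of the arguments, so one vanishing field suffices.
All later vanishing statements rest on this criterion. -/
theorem hamBracket_eq_zero {X : Fin k → ⨁ i, E Ω i} (j : Fin k) (hj : hamFieldE Ω (X j) = 0) :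
    hamBracket Ω θ k t h X = 0 := by
  have h0 : hamContraction Ω θ k (fun j => component ℝ ℤ (E Ω) (-1) (X j)) = 0 := by
    change contraction k (fun j => hamFieldE Ω (X j)) θ = 0
    rw [(contraction k).map_coord_zero j hj, LinearMap.zero_apply]
  change lof ℝ ℤ (E Ω) t ⟨hamContraction Ω θ k (fun j => component ℝ ℤ (E Ω) (-1) (X j)), _⟩ = 0
  rw [← map_zero (lof ℝ ℤ (E Ω) t)]
  exact congrArg _ (Subtype.ext h0)

theorem hamBracket_swap (X : Fin k → ⨁ i, E Ω i) {p q : Fin k} (hpq : (q : ℕ) = p + 1) :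
    hamBracket Ω θ k t h (X ∘ Equiv.swap p q) = -hamBracket Ω θ k t h X := by
  change lof ℝ ℤ (E Ω) t ⟨contraction k ((fun j => hamFieldE Ω (X j)) ∘ Equiv.swap p q) θ, _⟩ =
    -lof ℝ ℤ (E Ω) t ⟨contraction k (fun j => hamFieldE Ω (X j)) θ, _⟩
  rw [← map_neg]
  exact congrArg _ (Subtype.ext (contraction_swap θ _ hpq))

/-- Ordinary antisymmetry is graded symmetry here: two arguments of degree `-1` have exchange sign
`-1`, and an argument of any other degree makes both sides zero. -/
theorem hamBracket_swap_of_isHomog {a : Fin k → ℤ} {X : Fin k → ⨁ i, E Ω i} (hX : IsHomog a X)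
    {p q : Fin k} (hpq : (q : ℕ) = p + 1) :
    hamBracket Ω θ k t h (X ∘ Equiv.swap p q) =
      (a p * a q).negOnePow • hamBracket Ω θ k t h X := by
  rw [hamBracket_swap X hpq]
  by_cases hp : a p = -1
  · by_cases hq : a q = -1
    · rw [hp, hq]
      simp
    · rw [hamBracket_eq_zero q (hamFieldE_eq_zero Ω hq (hX q)), smul_zero, neg_zero]
  · rw [hamBracket_eq_zero p (hamFieldE_eq_zero Ω hp (hX p)), smul_zero, neg_zero]

/-- If all degrees are `-1`, they add up to `-k` and the target degree is `t`. Otherwise the value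
is zero, which lies in every degree. -/
theorem hamBracket_mem_of_isHomog {a : Fin k → ℤ} {X : Fin k → ⨁ i, E Ω i} (hX : IsHomog a X)
    {e : ℤ} (ht : t = e - k) :
    hamBracket Ω θ k t h X ∈ LinearMap.range (lof ℝ ℤ (E Ω) (∑ j, a j + e)) := by
  by_cases ha : ∀ j, a j = -1
  · refine range_lof_congr ?_ (hamBracket_mem X)
    simp [ha, ht]
    ring
  · push Not at ha
    obtain ⟨j, hj⟩ := ha
    rw [hamBracket_eq_zero j (hamFieldE_eq_zero Ω hj (hX j))]
    exact zero_mem _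

end hamBracket

/-! ### Symmetry, degree and vanishing of the brackets and of `η̃` -/

variable (s : ℤˣ) (η : Form F M n)

theorem l_add_two_eq_zero {k : ℕ} (hk : ¬k + 2 ≤ n + 1) : l Ω s (k + 2) = 0 := dif_neg hk

theorem l_add_two_apply {k : ℕ} (hk : k + 2 ≤ n + 1) (X : Fin (k + 2) → ⨁ i, E Ω i) :
    l Ω s (k + 2) X = bracketSign (k + 2) •
      hamBracket Ω Ω.toForms (k + 2) (1 - ((k + 2 : ℕ) : ℤ)) (hamContraction_toForms_mem Ω hk) X := by
  rw [l, dif_pos hk]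
  rfl

theorem l_add_two_eq_zero_of_hamFieldE {k : ℕ} {X : Fin (k + 2) → ⨁ i, E Ω i} (j : Fin (k + 2))
    (hj : hamFieldE Ω (X j) = 0) : l Ω s (k + 2) X = 0 := by
  by_cases hk : k + 2 ≤ n + 1
  · rw [l_add_two_apply Ω s hk, hamBracket_eq_zero j hj, smul_zero]
  · rw [l_add_two_eq_zero Ω s hk]
    rfl

theorem etaTilde_eq_zero {i : ℕ} (hi : ¬(2 ≤ i ∧ i ≤ n)) : etaTilde Ω η i = 0 := dif_neg hi

theorem etaTilde_eq {i : ℕ} (hi : 2 ≤ i ∧ i ≤ n) : etaTilde Ω η i =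
    hamBracket Ω (Pi.single n η) i (-(i : ℤ)) (hamContraction_single_mem Ω η hi) := dif_pos hi

theorem etaTilde_eq_zero_of_hamFieldE {i : ℕ} {X : Fin i → ⨁ i, E Ω i} (j : Fin i)
    (hj : hamFieldE Ω (X j) = 0) : etaTilde Ω η i X = 0 := by
  by_cases hi : 2 ≤ i ∧ i ≤ n
  · rw [etaTilde_eq Ω η hi, hamBracket_eq_zero j hj]
  · rw [etaTilde_eq_zero Ω η hi]
    rfl

theorem etaTilde_mem {i : ℕ} (X : Fin i → ⨁ i, E Ω i) :
    etaTilde Ω η i X ∈ LinearMap.range (lof ℝ ℤ (E Ω) (-(i : ℤ))) := by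
  by_cases hi : 2 ≤ i ∧ i ≤ n
  · rw [etaTilde_eq Ω η hi]
    exact hamBracket_mem X
  · rw [etaTilde_eq_zero Ω η hi]
    exact zero_mem _

/-- A nonzero `η̃_i` has `i ≥ 2`, so its values lie in degree `-i`, away from `-1`. -/
theorem hamFieldE_etaTilde {i : ℕ} (X : Fin i → ⨁ i, E Ω i) :
    hamFieldE Ω (etaTilde Ω η i X) = 0 := by
  by_cases hi : 2 ≤ i ∧ i ≤ n
  · exact hamFieldE_eq_zero Ω (by omega) (etaTilde_mem Ω η X)
  · rw [etaTilde_eq_zero Ω η hi]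
    exact map_zero _

theorem mu_eq : mu Ω s = l Ω s := by
  refine sum_pi_single _ _ fun k hk => ?_
  match k with
  | 0 => rfl
  | 1 => simp at hk
  | k + 2 => exact l_add_two_eq_zero Ω s (by simp at hk; omega)

theorem etaSum_eq : etaSum Ω η = fun i => etaTilde Ω η i :=
  sum_pi_single _ _ fun _ hk => etaTilde_eq_zero Ω η (by simpa using hk)

theorem isGradedSymmetric_l : IsGradedSymmetric (l Ω s : VForm (E Ω)) := by
  refine isGradedSymmetric_of_map_swap fun k a X p q hX hpq => ?_
  match k with
  | 0 => exact p.elim0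
  | 1 => omega
  | k + 2 =>
    by_cases hk : k + 2 ≤ n + 1
    · rw [l_add_two_apply Ω s hk, l_add_two_apply Ω s hk, hamBracket_swap_of_isHomog hX hpq,
        smul_comm]
    · rw [l_add_two_eq_zero Ω s hk, _root_.zero_apply, _root_.zero_apply, smul_zero]

theorem l1_mem {i : ℤ} {x : ⨁ i, E Ω i} (hx : x ∈ LinearMap.range (lof ℝ ℤ (E Ω) i)) :
    l1 Ω s x ∈ LinearMap.range (lof ℝ ℤ (E Ω) (i + 1)) := by
  obtain ⟨x, rfl⟩ := hx
  rw [l1, toModule_lof]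
  exact units_smul_mem (s * i.negOnePow) ⟨dComp Ω i x, rfl⟩

theorem l1_eq_dE {i : ℤ} {x : ⨁ i, E Ω i} (hx : x ∈ LinearMap.range (lof ℝ ℤ (E Ω) i)) :
    l1 Ω s x = (s * i.negOnePow) • dE Ω x := by
  obtain ⟨x, rfl⟩ := hx
  rw [l1, dE, toModule_lof, toModule_lof]
  rfl

theorem hasDegree_l : HasDegree (l Ω s : VForm (E Ω)) 1 := by
  refine hasDegree_of_mem fun k a X hX => ?_
  match k with
  | 0 => exact zero_mem _
  | 1 => exact range_lof_congr (by simp) (l1_mem Ω s (hX 0))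
  | k + 2 =>
    by_cases hk : k + 2 ≤ n + 1
    · rw [l_add_two_apply Ω s hk]
      exact units_smul_mem _ (hamBracket_mem_of_isHomog hX rfl)
    · rw [l_add_two_eq_zero Ω s hk]
      exact zero_mem _

theorem isGradedSymmetric_etaTilde : IsGradedSymmetric (fun i => etaTilde Ω η i) := by
  refine isGradedSymmetric_of_map_swap fun k a X p q hX hpq => ?_
  by_cases hk : 2 ≤ k ∧ k ≤ n
  · rw [etaTilde_eq Ω η hk, hamBracket_swap_of_isHomog hX hpq]
  · rw [etaTilde_eq_zero Ω η hk, _root_.zero_apply, _root_.zero_apply, smul_zero]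

theorem hasDegree_etaTilde : HasDegree (fun i => etaTilde Ω η i) 0 := by
  refine hasDegree_of_mem fun k a X hX => ?_
  by_cases hk : 2 ≤ k ∧ k ≤ n
  · rw [etaTilde_eq Ω η hk]
    exact hamBracket_mem_of_isHomog hX (by simp)
  · rw [etaTilde_eq_zero Ω η hk]
    exact zero_mem _

/-! ### The deformed structure -/

/-- The compositions `l_1 ∘ η̃_i`. -/
def l1EtaTilde : VForm (E Ω) := fun i => (l1 Ω s).compMultilinearMap (etaTilde Ω η i)

/-- A value of `η̃` has zero field, so among the brackets only `l_1` can be nonzero on it. -/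
theorem insertion_etaTilde_l :
    insertion (fun i => etaTilde Ω η i) (l Ω s) = l1EtaTilde Ω s η := by
  have h : insertion (fun i => etaTilde Ω η i) (l Ω s) =
      insertion (fun i => etaTilde Ω η i) (Pi.single 1 (l Ω s 1)) := by
    refine VForm.ext_homog fun m a X hX => ?_
    rw [insertion_apply _ _ hX, insertion_apply _ _ hX]
    refine Finset.sum_congr rfl fun t _ => congrArg _ ?_
    rw [insertValue, insertValue]
    -- With the size `c` of the complement made a variable, the outer bracket is `l_1` for `c = 0`
    -- and otherwise some `l_k` with `k ≥ 2`.
    generalize tᶜ.orderEmbOfFin rfl = f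
    revert f
    generalize tᶜ.card = c
    intro f
    match c with
    | 0 => rw [Pi.single_eq_same]
    | c + 1 =>
      rw [Pi.single_eq_of_ne (by omega), _root_.zero_apply]
      exact l_add_two_eq_zero_of_hamFieldE Ω s 0 (hamFieldE_etaTilde Ω η _)
  rw [h]
  refine VForm.ext_homog fun m a X hX => ?_
  rw [insertion_apply_of_unary (fun k hk => Pi.single_eq_of_ne hk _) hX, Pi.single_eq_same]
  rfl

/-- Among the brackets only `l_2` can take values with nonzero field, and `η̃` annihilates all
others. -/
theorem insertion_l_etaTilde : insertion (l Ω s) (fun i => etaTilde Ω η i) =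
    insertion (Pi.single 2 (l Ω s 2)) (fun i => etaTilde Ω η i) := by
  refine insertion_congr_left fun k c a X Y _ => ?_
  by_cases hk : k = 2
  · subst hk
    rw [Pi.single_eq_same]
  · rw [Pi.single_eq_of_ne hk, _root_.zero_apply,
      etaTilde_eq_zero_of_hamFieldE Ω η (X := Fin.cons 0 Y) 0 (map_zero _)]
    refine etaTilde_eq_zero_of_hamFieldE Ω η 0 ?_
    rw [Fin.cons_zero]
    match k with
    | 0 => exact map_zero _
    | 1 => exact hamFieldE_l1 Ω s _
    | 2 => exact absurd rfl hk
    | k + 3 =>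
      by_cases hk' : k + 1 + 2 ≤ n + 1
      · rw [l_add_two_apply Ω s hk']
        -- Brackets of arity at least `3` take values in degree at most `-2`.
        exact hamFieldE_eq_zero Ω (i := 1 - ((k + 1 + 2 : ℕ) : ℤ)) (by push_cast; omega)
          (units_smul_mem _ (hamBracket_mem X))
      · rw [l_add_two_eq_zero Ω s hk']
        exact map_zero _

theorem rnBracket_etaTilde_l : rnBracket 0 1 (fun i => etaTilde Ω η i) (l Ω s) =
    l1EtaTilde Ω s η - insertion (Pi.single 2 (l Ω s 2)) (fun i => etaTilde Ω η i) := by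
  rw [rnBracket, zero_mul, Int.negOnePow_zero, one_smul, insertion_etaTilde_l,
    insertion_l_etaTilde]

/-- In each shuffle the argument `X j` is fed either to `l_2` or directly to `η̃`, and both vanish
on it. -/
theorem insertion_l_two_eq_zero {m : ℕ} {a : Fin m → ℤ} {X : Fin m → ⨁ i, E Ω i}
    (hX : IsHomog a X) (j : Fin m) (hj : hamFieldE Ω (X j) = 0) :
    insertion (Pi.single 2 (l Ω s 2)) (fun i => etaTilde Ω η i) m X = 0 := by
  rw [insertion_apply _ _ hX]
  refine Finset.sum_eq_zero fun t _ => ?_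
  have hr : ∀ {u : Finset (Fin m)}, j ∈ u → ∃ r, u.orderEmbOfFin rfl r = j := fun {u} hx => by
    have := u.range_orderEmbOfFin rfl
    rw [← Finset.mem_coe, ← this] at hx
    exact hx
  rw [insertValue]
  by_cases h : j ∈ t
  · obtain ⟨r, hr⟩ := hr h
    rw [etaTilde_eq_zero_of_hamFieldE Ω η 0, smul_zero]
    rw [Fin.cons_zero]
    have h2 : (Pi.single 2 (l Ω s 2) : VForm (E Ω)) t.card (X ∘ t.orderEmbOfFin rfl) = 0 := by
      have hx : hamFieldE Ω ((X ∘ t.orderEmbOfFin rfl) r) = 0 := by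
        rw [Function.comp_apply, hr, hj]
      generalize X ∘ t.orderEmbOfFin rfl = Z at hx
      clear hr
      revert Z r
      generalize t.card = c
      intro r Z hx
      by_cases hc : c = 2
      · subst hc
        rw [Pi.single_eq_same]
        exact l_add_two_eq_zero_of_hamFieldE Ω s r hx
      · rw [Pi.single_eq_of_ne hc]
        rfl
    rw [h2, map_zero]
  · obtain ⟨r, hr⟩ := hr (Finset.mem_compl.2 h)
    rw [etaTilde_eq_zero_of_hamFieldE Ω η r.succ, smul_zero]
    rw [Fin.cons_succ, Function.comp_apply, hr, hj]

theorem rnBracket_rnBracket_etaTilde_l : rnBracket 0 1 (fun i => etaTilde Ω η i)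
    (rnBracket 0 1 (fun i => etaTilde Ω η i) (l Ω s)) = 0 := by
  rw [rnBracket_etaTilde_l, rnBracket, zero_mul, Int.negOnePow_zero, one_smul]
  -- Both parts of `[A, μ]` vanish when an argument is a value of `η̃`.
  have h1 : insertion (fun i => etaTilde Ω η i) (l1EtaTilde Ω s η -
      insertion (Pi.single 2 (l Ω s 2)) (fun i => etaTilde Ω η i)) = 0 := by
    refine insertion_eq_zero fun k c a b X Y _ hY => ?_
    have hZ := hY.cons (etaTilde_mem Ω η X)
    have h0 := hamFieldE_etaTilde Ω η X
    rw [Pi.sub_apply, _root_.sub_apply, insertion_l_two_eq_zero Ω s η hZ 0 h0, sub_zero]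
    change l1 Ω s (etaTilde Ω η (c + 1) _) = 0
    rw [etaTilde_eq_zero_of_hamFieldE Ω η 0 h0, map_zero]
  -- The values of `[A, μ]` are values of `l_1` minus signed sums of values of `η̃`, so they have
  -- zero field and `η̃` annihilates them.
  have h2 : insertion (l1EtaTilde Ω s η -
      insertion (Pi.single 2 (l Ω s 2)) (fun i => etaTilde Ω η i)) (fun i => etaTilde Ω η i) = 0 := by
    refine insertion_eq_zero fun k c a b X Y hX _ => etaTilde_eq_zero_of_hamFieldE Ω η 0 ?_
    rw [Fin.cons_zero, Pi.sub_apply, _root_.sub_apply, map_sub]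
    have e1 : hamFieldE Ω (l1EtaTilde Ω s η k X) = 0 := hamFieldE_l1 Ω s _
    rw [e1, zero_sub, neg_eq_zero, insertion_apply _ _ hX, map_sum]
    refine Finset.sum_eq_zero fun t _ => ?_
    have e2 := hamFieldE_etaTilde Ω η (Fin.cons ((Pi.single 2 (l Ω s 2) : VForm (E Ω)) t.card
      (X ∘ t.orderEmbOfFin rfl)) (X ∘ tᶜ.orderEmbOfFin rfl))
    rcases Int.units_eq_one_or (koszulSign t a) with hu | hu
    · rw [hu, one_smul]; exact e2
    · rw [hu, Units.neg_smul, one_smul, map_neg, neg_eq_zero]; exact e2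
  rw [h1, h2, sub_zero]

theorem deformed_eq : (∑ i ∈ Finset.Icc 1 (n + 1), Pi.single i (deformed Ω s η i) : VForm (E Ω)) =
    l Ω s + rnBracket 0 1 (fun i => etaTilde Ω η i) (l Ω s) := by
  rw [rnBracket_etaTilde_l, sum_pi_single _ (deformed Ω s η)]
  · funext i
    rw [Pi.add_apply, Pi.sub_apply, deformed]
    split_ifs with hi
    · subst hi
      -- In arity one there is no correction: `η̃_1 = 0`, and inserting a binary form never gives a
      -- unary one.
      rw [insertion_single_two_of_lt _ _ (by norm_num), sub_zero, l1EtaTilde,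
        etaTilde_eq_zero Ω η (by omega), LinearMap.compMultilinearMap_zero, add_zero]
    · have e : (s * (-1) ^ i) • (dE Ω).compMultilinearMap (etaTilde Ω η i) =
          l1EtaTilde Ω s η i := by
        refine MultilinearMap.ext fun X => ?_
        refine Eq.trans ?_ (l1_eq_dE Ω s (etaTilde_mem Ω η X)).symm
        -- The value of `η̃_i` has degree `-i`, so `l_1` acts on it as `s (-1)^i d`.
        rw [Int.negOnePow_neg, Int.negOnePow_def, zpow_natCast]
        rfl
      rw [e, insertion_single_two_apply _ (fun i => etaTilde Ω η i), add_sub_assoc]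
  · intro k hk
    -- Outside the range of summation every term vanishes. For `k = 0` the truncated index `k - 1`
    -- is `0`; for `k ≥ n + 2` it is at least `n + 1`, where `η̃` is zero.
    have hk' : k = 0 ∨ n + 2 ≤ k := by simp at hk; omega
    rw [deformed, if_neg (by omega), etaTilde_eq_zero Ω η (i := k) (by omega),
      etaTilde_eq_zero Ω η (i := k - 1) (by omega), Pi.single_zero, insertion_zero_right]
    have hl : l Ω s k = 0 := by
      match k with
      | 0 => rfl
      | 1 => omega
      | k + 2 => exact l_add_two_eq_zero Ω s (by omega)
    rw [hl, LinearMap.compMultilinearMap_zero, smul_zero]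
    simp

end
end NPlectic
end

theorem mainTheorem6 {F : Type*} [NormedAddCommGroup F] [NormedSpace ℝ F] [FiniteDimensional ℝ F]
    {M : Type*} [TopologicalSpace M] [ChartedSpace F M] [IsManifold 𝓘(ℝ, F) ∞ M]
    (n : ℕ) (Ω : NPlectic.NPlecticForm F M n) (η : NPlectic.Form F M n) (s : ℤˣ) :
    NPlectic.IsNijenhuisWithSquare (NPlectic.mu Ω s)
      (NPlectic.euler (NPlectic.E Ω) + NPlectic.etaSum Ω η)
      (NPlectic.euler (NPlectic.E Ω) + (2 : ℝ) • NPlectic.etaSum Ω η) ∧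
    NPlectic.rnBracket 0 1 (NPlectic.euler (NPlectic.E Ω) + NPlectic.etaSum Ω η)
        (NPlectic.mu Ω s) =
      ∑ i ∈ Finset.Icc 1 (n + 1), Pi.single i (NPlectic.deformed Ω s η i) := by
  rw [NPlectic.mu_eq, NPlectic.etaSum_eq, NPlectic.deformed_eq]
  have hl := NPlectic.isGradedSymmetric_l Ω s
  have hd := NPlectic.hasDegree_l Ω s
  refine ⟨NPlectic.isNijenhuisWithSquare_euler_add hl hd (NPlectic.isGradedSymmetric_etaTilde Ω η)
    (NPlectic.hasDegree_etaTilde Ω η) (NPlectic.rnBracket_rnBracket_etaTilde_l Ω s η), ?_⟩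
  rw [NPlectic.rnBracket_zero_add_left, NPlectic.rnBracket_euler hl hd, Int.cast_one, one_smul]
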